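/- **Setting.** Let $\mathcal M=\sum_{i=1}^{J}\delta_{X_i}$ be a point process on $\mathbb R$ with a random number $J\in\{0,1,2,\dots\}\cup\{\infty\}$ of points (the dependence between $J,X_1,X_2,\dots$ is arbitrary), let $\mu$ be its intensity measure, and assume $\mathbb E J>1$. In the branching random walk driven by $\mathcal M$, the ancestor $\varnothing$ has position $S(\varnothing)=0$, every individual $u$ has children $ui$, $1\le i\le J(u)$ ($i\ge 1$ if $J(u)=\infty$), at positions $S(ui)=S(u)+X_i(u)$, and the families $(J(u),X_1(u),X_2(u),\dots)$, for $u$ ranging over the finite words over $\mathbb N$, are independent copies of $(J,X_1,X_2,\dots)$. Write $|u|=n$ if $u$ belongs to the $n$-th generation. Put $m(z)=\int_{\mathbb R}e^{-zx}\,\mu(\mathrm dx)$ for those $z\in\mathbb C$ for which the integral converges absolutely, and, if moreover $m(z)\neq0$, $$Z_n(z)=\frac1{m(z)^n}\sum_{|u|=n}e^{-zS(u)},\qquad n=0,1,2,\dots$$ **Theorem.** Let $p\in(1,2)$, $\theta,\gamma\in\mathbb R\setminus\{0\}$, $\lambda=\theta+\mathrm i\gamma$ and $0<|m(\lambda)|<m(\theta)<\infty$.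 Assume that $Z_1(\lambda)$ is not almost surely equal to $1$, and that either * $\mathbb E|Z_1(\lambda)|^2<\infty$, in which case put $\alpha=2$; or * for some $\alpha\in(1,2)$, $$0<\liminf_{x\to\infty}x^\alpha\,\mathbb P\{|Z_1(\lambda)|>x\}\le\limsup_{x\to\infty}x^\alpha\,\mathbb P\{|Z_1(\lambda)|>x\}<\infty .$$ Assume further that $m(\alpha\theta)<\infty$ and that the martingale $(Z_n(\alpha\theta))_{n\ge0}$ is uniformly integrable. Then the martingale $(Z_n(\lambda))_{n\ge0}$ converges in $L^p$ if, and only if, $$p<\alpha\qquad\text{and}\qquad \frac{m(\alpha\theta)}{|m(\lambda)|^\alpha}<1 .$$ -/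

import Mathlib

open MeasureTheory ProbabilityTheory Filter
open scoped ENNReal Topology

noncomputable section

/-- The input of a branching random walk on `(Ω, P)`. Individuals are words over `ℕ`; a word
`u₁ … uₙ` is stored with its last letter first, so that `i :: u` is the child number `i` of `u`
(children are numbered from `0`) and `[]` is the ancestor. The individual `u` has
`J u ω ∈ {0, 1, …, ∞}` children, with displacements `X u i ω` for `i < J u ω`; the values
`X u i ω` for `i ≥ J u ω` are never used. The families `(J u, X u 0, X u 1, …)` are i.i.d. in `u`,
with arbitrary dependence inside each of them. -/
structure BranchingRandomWalk {Ω : Type*} [MeasurableSpace Ω] (P : Measure Ω) where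
  J : List ℕ → Ω → ℕ∞
  X : List ℕ → ℕ → Ω → ℝ
  measurable_J : ∀ u, Measurable (J u)
  measurable_X : ∀ u i, Measurable (X u i)
  indep : iIndepFun (fun (u : List ℕ) (ω : Ω) => (J u ω, fun i => X u i ω)) P
  identDistrib : ∀ u, IdentDistrib (fun ω => (J u ω, fun i => X u i ω))
    (fun ω => (J [] ω, fun i => X [] i ω)) P P

namespace BranchingRandomWalk

variable {Ω : Type*} [MeasurableSpace Ω] {P : Measure Ω} (B : BranchingRandomWalk P)

/-- The point process `∑_{i < J u} δ_{X u i}` of the displacements of the children of `u`. -/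
def offspring (u : List ℕ) (ω : Ω) : Measure ℝ :=
  Measure.sum fun i : ℕ => {ω' | (i : ℕ∞) < B.J u ω'}.indicator
    (fun ω' => Measure.dirac (B.X u i ω')) ω

lemma measurable_offspring (u : List ℕ) : Measurable (B.offspring u) := by
  refine Measure.measurable_of_measurable_coe _ fun s hs => ?_
  simp only [offspring, Measure.sum_apply _ hs]
  refine Measurable.tsum fun i => ?_
  have h : Measurable ({ω' | (i : ℕ∞) < B.J u ω'}.indicator
      (fun ω' => Measure.dirac (B.X u i ω'))) :=
    (Measure.measurable_dirac.comp (B.measurable_X u i)).indicator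
      (B.measurable_J u (MeasurableSet.of_discrete (s := {j : ℕ∞ | (i : ℕ∞) < j})))
  exact (Measure.measurable_coe hs).comp h

/-- The intensity measure `μ(A) = E[𝓜(A)]` of the offspring point process. -/
def intensity : Measure ℝ := P.bind (B.offspring [])

lemma intensity_apply {s : Set ℝ} (hs : MeasurableSet s) :
    B.intensity s = ∫⁻ ω, B.offspring [] ω s ∂P :=
  Measure.bind_apply hs (B.measurable_offspring []).aemeasurable

/-- The Laplace transform `m(z) = ∫ e^{-zx} μ(dx)` at a complex argument. -/
def laplace (z : ℂ) : ℂ := ∫ x : ℝ, Complex.exp (-z * x) ∂B.intensity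

/-- For real `t`, `m(t) < ∞`. -/
def LaplaceFinite (t : ℝ) : Prop := Integrable (fun x : ℝ => Real.exp (-t * x)) B.intensity

/-- The Laplace transform at a real argument, as a real number. -/
def laplaceReal (t : ℝ) : ℝ := ∫ x : ℝ, Real.exp (-t * x) ∂B.intensity

lemma laplace_ofReal (t : ℝ) : B.laplace (t : ℂ) = (B.laplaceReal t : ℂ) := by
  rw [laplace, laplaceReal, ← integral_complex_ofReal]
  simp

/-- The position `S(u)`. -/
def position : List ℕ → Ω → ℝ
  | [], _ => 0
  | i :: u, ω => position u ω + B.X u i ω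

/-- The individual `u` is actually born. -/
def Born : List ℕ → Ω → Prop
  | [], _ => True
  | i :: u, ω => Born u ω ∧ (i : ℕ∞) < B.J u ω

/-- The individuals of the `n`-th generation. -/
def generation (n : ℕ) (ω : Ω) : Set (List ℕ) := {u | u.length = n ∧ B.Born u ω}

/-- The Biggins martingale `Z_n(z) = m(z)^{-n} ∑_{|u| = n} e^{-z S(u)}`. -/
def biggins (n : ℕ) (z : ℂ) (ω : Ω) : ℂ :=
  (B.laplace z ^ n)⁻¹ *
    ∑' u : List ℕ, (B.generation n ω).indicator (fun u => Complex.exp (-z * B.position u ω)) u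

end BranchingRandomWalk

/-- `(f n)` converges in `L^p(P)`: all `f n` lie in `L^p`, and so does some `g` with
`‖f n - g‖_p → 0`. -/
def ConvergesInLp {Ω : Type*} [MeasurableSpace Ω] (P : Measure Ω) (f : ℕ → Ω → ℂ)
    (p : ℝ) : Prop :=
  (∀ n, MemLp (f n) (ENNReal.ofReal p) P) ∧
    ∃ g : Ω → ℂ, MemLp g (ENNReal.ofReal p) P ∧
      Tendsto (fun n => eLpNorm (fun ω => f n ω - g ω) (ENNReal.ofReal p) P) atTop (𝓝 0)

/-- `0 < liminf x^α P{|Y| > x} ≤ limsup x^α P{|Y| > x} < ∞` as `x → ∞`. -/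
def HasPowerTail {Ω : Type*} [MeasurableSpace Ω] (P : Measure Ω) (Y : Ω → ℂ) (α : ℝ) : Prop :=
  0 < liminf (fun x : ℝ => ENNReal.ofReal (x ^ α) * P {ω | x < ‖Y ω‖}) atTop ∧
    limsup (fun x : ℝ => ENNReal.ofReal (x ^ α) * P {ω | x < ‖Y ω‖}) atTop < ∞

end

/-! Attach to each individual u the copy ξ_u of Z_1(λ) - 1 built from its own family, and put a_u =
e^{-λS(u)} / m(λ)^n for |u| = n. Then Z_{n+1}(λ) - Z_n(λ) = Σ_{|u|=n} a_u ξ_u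
(`hasSum_biggins_succ_sub`), where the ξ_u are i.i.d., centered and independent of the coefficients
of generation n. Moreover Σ_{|u|=n} |a_u|^α = q^n Z_n(αθ) almost surely, with q = m(αθ)/|m(λ)|^α
(`tsum_coef_rpow_eq`, `enorm_biggins_ofReal`). So the question is how a weighted sum of the ξ_u
compares with the ℓ^α norm of its weights.

Upper bound. For fixed weights, P(|Σ a_u ξ_u| > x) ≤ C Σ|a_u|^α x^{-α}: by Chebyshev if α = 2
(`measure_lt_norm_sum_le_of_sq`), by truncation of each summand at height x if α < 2
(`exists_measure_lt_norm_sum_le`). Averaging over the coefficients, with E Σ|a_u|^α = q^n, bounds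
the L^p norm of the increment by a constant times q^{n/α} whenever p < α. If q < 1 these bounds are
summable and the martingale is Cauchy.

Lower bound. Conversely E|Σ a_u ξ_u| ≥ c (Σ|a_u|^α)^{1/α}. The L¹ norm controls the square function
(`lintegral_sqrt_sum_sq_le`); the square function is bounded below by Cauchy–Schwarz if α = 2 and by
its largest term if α < 2. Hence E|Z_{n+1} - Z_n| ≥ c' q^{n/α} E[Z_n(αθ)^{1/α}] with c' > 0, and the
last expectation stays away from 0 because Z_n(αθ) is uniformly integrable with mean 1. If q ≥ 1 the
increments therefore do not vanish in L¹, let alone in L^p. Finally, p < α is forced when α < 2,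
since a tail of order x^{-α} keeps Z_1(λ) out of L^α (`HasPowerTail.lt_of_memLp`). -/

/-! ### Truncated moments under a power tail -/

section TailMoments

variable {Ω : Type*} [MeasurableSpace Ω] {P : Measure Ω}

theorem lintegral_Ioc_rpow {r y : ℝ} (hr : -1 < r) (hy : 0 ≤ y) {c : ℝ} (hc : 0 ≤ c) :
    ∫⁻ t in Set.Ioc 0 y, ENNReal.ofReal (c * t ^ r) = ENNReal.ofReal (c * y ^ (r + 1) / (r + 1)) := by
  have hint : IntegrableOn (fun t : ℝ => c * t ^ r) (Set.Ioc 0 y) := by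
    have := (intervalIntegral.intervalIntegrable_rpow' (a := 0) (b := y) hr).const_mul c
    rwa [intervalIntegrable_iff_integrableOn_Ioc_of_le hy] at this
  rw [← ofReal_integral_eq_lintegral_ofReal hint]
  · rw [← intervalIntegral.integral_of_le hy, intervalIntegral.integral_const_mul,
      integral_rpow (Or.inl hr), Real.zero_rpow (by linarith)]
    congr 1
    ring
  · filter_upwards [ae_restrict_mem measurableSet_Ioc] with t ht
    have := ht.1.le
    positivity

theorem lintegral_Ioi_rpow {r y : ℝ} (hr : r < -1) (hy : 0 < y) {c : ℝ} (hc : 0 ≤ c) :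
    ∫⁻ t in Set.Ioi y, ENNReal.ofReal (c * t ^ r)
      = ENNReal.ofReal (c * y ^ (r + 1) / (-(r + 1))) := by
  have hint : IntegrableOn (fun t : ℝ => c * t ^ r) (Set.Ioi y) :=
    (integrableOn_Ioi_rpow_of_lt hr hy).const_mul c
  rw [← ofReal_integral_eq_lintegral_ofReal hint]
  · rw [integral_const_mul, integral_Ioi_rpow_of_lt hr hy]
    congr 1
    rw [div_neg, neg_div]
    ring
  · filter_upwards [ae_restrict_mem measurableSet_Ioi] with t ht
    have : 0 < t := hy.trans ht
    positivity

/-- Layer-cake formula: only levels t ≤ y contribute, and t · t^{-α} is integrable at 0 because α <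
2. -/
theorem lintegral_min_sq_le {f : Ω → ℝ} (hf : Measurable f) (hf0 : ∀ ω, 0 ≤ f ω) {K α : ℝ}
    (hK : 0 ≤ K) (hα2 : α < 2)
    (htail : ∀ t, 0 < t → P {ω | t < f ω} ≤ ENNReal.ofReal (K * t ^ (-α))) {y : ℝ} (hy : 0 ≤ y) :
    ∫⁻ ω, ENNReal.ofReal (min (f ω) y ^ (2 : ℝ)) ∂P
      ≤ ENNReal.ofReal (2 * (K * y ^ (2 - α) / (2 - α))) := by
  rw [lintegral_rpow_eq_lintegral_meas_lt_mul P (ae_of_all _ fun ω => le_min (hf0 ω) hy)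
    (hf.min measurable_const).aemeasurable two_pos, ENNReal.ofReal_mul two_pos.le]
  gcongr
  have h1 : ∀ t ∈ Set.Ioi (0 : ℝ), P {ω | t < min (f ω) y} * ENNReal.ofReal (t ^ ((2 : ℝ) - 1))
      ≤ (Set.Ioc 0 y).indicator (fun t => ENNReal.ofReal (K * t ^ (1 - α))) t := by
    intro t ht
    rw [Set.mem_Ioi] at ht
    by_cases hty : t ≤ y
    · rw [Set.indicator_of_mem (Set.mem_Ioc.2 ⟨ht, hty⟩)]
      calc _ ≤ ENNReal.ofReal (K * t ^ (-α)) * ENNReal.ofReal (t ^ ((2 : ℝ) - 1)) := by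
            gcongr
            refine le_trans (measure_mono fun ω hω => ?_) (htail t ht)
            have hω' : t < min (f ω) y := hω
            exact (lt_min_iff.1 hω').1
        _ = _ := by
            rw [← ENNReal.ofReal_mul (by positivity), mul_assoc, ← Real.rpow_add ht]
            congr 3
            ring
    · have : {ω | t < min (f ω) y} = ∅ := by
        ext ω
        simp only [Set.mem_ofPred_eq, lt_min_iff, Set.mem_empty_iff_false, iff_false, not_and]
        intro _ h
        exact hty h.le
      rw [this, measure_empty, zero_mul]
      exact zero_le
  calc _ ≤ ∫⁻ t in Set.Ioi 0, (Set.Ioc 0 y).indicator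
          (fun t => ENNReal.ofReal (K * t ^ (1 - α))) t := by
        refine setLIntegral_mono ?_ h1
        exact Measurable.indicator (by fun_prop) measurableSet_Ioc
    _ ≤ ∫⁻ t in Set.Ioc 0 y, ENNReal.ofReal (K * t ^ (1 - α)) := by
        rw [← lintegral_indicator measurableSet_Ioc]
        exact lintegral_mono' Measure.restrict_le_self le_rfl
    _ = _ := by
        rw [lintegral_Ioc_rpow (by linarith) hy hK]
        have e : 1 - α + 1 = 2 - α := by ring
        rw [e]

/-- Layer-cake formula split at y: below y every level contributes the constant P(f > y), which
gives the 1 in the factor; above y the tail integral converges because p < α and gives p / (α - p).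
-/
theorem lintegral_rpow_tail_le {f : Ω → ℝ} (hf : Measurable f) (hf0 : ∀ ω, 0 ≤ f ω) {K α p : ℝ}
    (hK : 0 ≤ K) (hp : 0 < p) (hpα : p < α)
    (htail : ∀ t, 0 < t → P {ω | t < f ω} ≤ ENNReal.ofReal (K * t ^ (-α))) {y : ℝ} (hy : 0 < y) :
    ∫⁻ ω, ENNReal.ofReal (({ω | y < f ω}.indicator f ω) ^ p) ∂P
      ≤ ENNReal.ofReal (K * (1 + p / (α - p)) * y ^ (p - α)) := by
  have hs : MeasurableSet {ω | y < f ω} := measurableSet_lt measurable_const hf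
  rw [lintegral_rpow_eq_lintegral_meas_lt_mul P
    (ae_of_all _ fun ω => Set.indicator_nonneg (fun _ _ => hf0 _) ω)
    (hf.indicator hs).aemeasurable hp, ← Set.Ioc_union_Ioi_eq_Ioi hy.le]
  have hsub : ∀ t, 0 < t → ∀ ω, t < {ω | y < f ω}.indicator f ω → y < f ω ∧ t < f ω := by
    intro t ht ω hω
    by_cases h : y < f ω
    · rw [Set.indicator_of_mem (by exact h)] at hω
      exact ⟨h, hω⟩
    · rw [Set.indicator_of_notMem (by exact h)] at hω
      exact absurd hω ht.not_gt
  have h1 : ∫⁻ t in Set.Ioc 0 y, P {ω | t < {ω | y < f ω}.indicator f ω}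
      * ENNReal.ofReal (t ^ (p - 1)) ≤ ENNReal.ofReal (K * y ^ (-α) * y ^ (p - 1 + 1) / (p - 1 + 1)) := by
    rw [← lintegral_Ioc_rpow (by linarith) hy.le (by positivity)]
    refine setLIntegral_mono (by fun_prop) fun t ht => ?_
    rw [ENNReal.ofReal_mul (by positivity)]
    gcongr
    exact (measure_mono fun ω hω => (hsub t ht.1 ω hω).1).trans (htail y hy)
  have h2 : ∫⁻ t in Set.Ioi y, P {ω | t < {ω | y < f ω}.indicator f ω}
      * ENNReal.ofReal (t ^ (p - 1))
      ≤ ENNReal.ofReal (K * y ^ (p - 1 - α + 1) / (-(p - 1 - α + 1))) := by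
    rw [← lintegral_Ioi_rpow (by linarith) hy hK]
    refine setLIntegral_mono (by fun_prop) fun t ht => ?_
    have ht0 : 0 < t := hy.trans ht
    calc _ ≤ ENNReal.ofReal (K * t ^ (-α)) * ENNReal.ofReal (t ^ (p - 1)) := by
          gcongr
          exact (measure_mono fun ω hω => (hsub t ht0 ω hω).2).trans (htail t ht0)
      _ = _ := by
          rw [← ENNReal.ofReal_mul (by positivity), mul_assoc, ← Real.rpow_add ht0]
          congr 3
          ring
  refine (mul_le_mul_right (lintegral_union_le _ _ _) _).trans ?_
  refine (mul_le_mul_right (add_le_add h1 h2) _).trans ?_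
  have hpα' : 0 < α - p := by linarith
  have hd : -(p - 1 - α + 1) = α - p := by ring
  rw [hd, ← ENNReal.ofReal_add (by ring_nf; positivity) (by positivity),
    ← ENNReal.ofReal_mul hp.le]
  refine ENNReal.ofReal_le_ofReal (le_of_eq ?_)
  have e1 : p - 1 - α + 1 = p - α := by ring
  have e2 : p - 1 + 1 = p := by ring
  rw [e1, e2, mul_assoc K, ← Real.rpow_add hy, neg_add_eq_sub]
  field_simp

end TailMoments

/-! ### Centered truncation -/

section Truncation

variable {Ω : Type*} [MeasurableSpace Ω] {P : Measure Ω} [IsProbabilityMeasure P]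

/-- A centered variable with a tail of order `t ^ (-α)` is the sum of two centered functions of it:
one with second moment of order `y ^ (2 - α)` and one with first moment of order `y ^ (1 - α)`. -/
theorem exists_truncation {ξ : Ω → ℂ} (hξ : Measurable ξ) (hint : Integrable ξ P)
    (hmean : ∫ ω, ξ ω ∂P = 0) {K α : ℝ} (hK : 0 ≤ K) (hα1 : 1 < α) (hα2 : α < 2)
    (htail : ∀ t, 0 < t → P {ω | t < ‖ξ ω‖} ≤ ENNReal.ofReal (K * t ^ (-α))) {y : ℝ} (hy : 0 < y) :
    ∃ g h : ℂ → ℂ, Measurable g ∧ Measurable h ∧ (∀ z, g z + h z = z) ∧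
      MemLp (fun ω => g (ξ ω)) 2 P ∧ ∫ ω, g (ξ ω) ∂P = 0 ∧
      ∫⁻ ω, ‖g (ξ ω)‖ₑ ^ 2 ∂P ≤ ENNReal.ofReal (8 * K / (2 - α) * y ^ (2 - α)) ∧
      ∫⁻ ω, ‖h (ξ ω)‖ₑ ∂P ≤ ENNReal.ofReal (2 * K * (1 + 1 / (α - 1)) * y ^ (1 - α)) := by
  set s : Set ℂ := {z | ‖z‖ ≤ y} with hs_def
  have hs : MeasurableSet s := measurableSet_le measurable_norm measurable_const
  set g₀ : ℂ → ℂ := s.indicator id with hg₀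
  have hg₀m : Measurable g₀ := measurable_id.indicator hs
  have hg₀b : ∀ z, ‖g₀ z‖ ≤ min ‖z‖ y := by
    intro z
    by_cases hz : z ∈ s
    · rw [hg₀, Set.indicator_of_mem hz, id]
      exact le_min le_rfl hz
    · rw [hg₀, Set.indicator_of_notMem hz, norm_zero]
      exact le_min (norm_nonneg _) hy.le
  set h₀ : ℂ → ℂ := sᶜ.indicator id with hh₀
  have hsum : ∀ z, g₀ z + h₀ z = z := fun z => by
    have := congrFun (Set.indicator_self_add_compl s (id : ℂ → ℂ)) z
    exact this
  have hg₀2 : MemLp (fun ω => g₀ (ξ ω)) 2 P :=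
    MemLp.of_bound (hg₀m.comp hξ).aestronglyMeasurable y
      (ae_of_all _ fun ω => (hg₀b _).trans (min_le_right _ _))
  have hg₀i : Integrable (fun ω => g₀ (ξ ω)) P := hg₀2.integrable (by norm_num)
  have hh₀i : Integrable (fun ω => h₀ (ξ ω)) P := by
    have : (fun ω => h₀ (ξ ω)) = fun ω => ξ ω - g₀ (ξ ω) := by
      ext ω
      exact eq_sub_of_add_eq' (hsum (ξ ω))
    rw [this]
    exact hint.sub hg₀i
  -- As ξ is centered, the tail part has mean -c, so moving the constant c from one part to the
  -- other centers both. The size of c is controlled by the L² norm of the bounded part and also by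
  -- the L¹ norm of the tail part, so centering costs only a factor 4 in the second moment and 2 in
  -- the first.
  set c : ℂ := ∫ ω, g₀ (ξ ω) ∂P with hc
  have hch : ∫ ω, h₀ (ξ ω) ∂P = -c := by
    have : ∫ ω, (g₀ (ξ ω) + h₀ (ξ ω)) ∂P = 0 := by
      simpa only [hsum] using hmean
    rw [integral_add hg₀i hh₀i] at this
    exact (neg_eq_of_add_eq_zero_right this).symm
  have hG : ∫⁻ ω, ‖g₀ (ξ ω)‖ₑ ^ 2 ∂P ≤ ENNReal.ofReal (2 * (K * y ^ (2 - α) / (2 - α))) := by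
    refine le_trans (lintegral_mono fun ω => ?_) (lintegral_min_sq_le hξ.norm
      (fun ω => norm_nonneg (ξ ω)) hK hα2 htail hy.le)
    rw [← ofReal_norm, ← ENNReal.ofReal_pow (norm_nonneg _), Real.rpow_two]
    gcongr
    exact hg₀b _
  have hH : ∫⁻ ω, ‖h₀ (ξ ω)‖ₑ ∂P ≤ ENNReal.ofReal (K * (1 + 1 / (α - 1)) * y ^ (1 - α)) := by
    refine le_trans (lintegral_mono fun ω => ?_) (lintegral_rpow_tail_le hξ.norm
      (fun ω => norm_nonneg (ξ ω)) hK one_pos hα1 htail hy)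
    rw [← ofReal_norm, Real.rpow_one]
    gcongr
    by_cases hz : y < ‖ξ ω‖
    · rw [Set.indicator_of_mem (by exact hz)]
      rw [hh₀, Set.indicator_of_mem (by simpa [hs_def] using hz), id]
    · rw [hh₀, Set.indicator_of_notMem (by simpa [hs_def] using hz), norm_zero]
      exact Set.indicator_nonneg (fun _ _ => norm_nonneg _) _
  have hcG : ‖c‖ₑ ^ 2 ≤ ∫⁻ ω, ‖g₀ (ξ ω)‖ₑ ^ 2 ∂P := by
    have h1 : ‖c‖ₑ ≤ eLpNorm (fun ω => g₀ (ξ ω)) 2 P := by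
      refine (enorm_integral_le_lintegral_enorm _).trans ?_
      rw [← eLpNorm_one_eq_lintegral_enorm]
      exact eLpNorm_le_eLpNorm_of_exponent_le (by norm_num) hg₀2.1
    calc ‖c‖ₑ ^ 2 ≤ (eLpNorm (fun ω => g₀ (ξ ω)) 2 P) ^ 2 := by gcongr
      _ = _ := by
        have := eLpNorm_nnreal_pow_eq_lintegral (μ := P) (p := 2) (f := fun ω => g₀ (ξ ω)) (by simp)
        simpa using this
  refine ⟨fun z => g₀ z - c, fun z => h₀ z + c, hg₀m.sub_const c,
    (measurable_id.indicator hs.compl).add_const c, fun z => ?_, hg₀2.sub (memLp_const c), ?_, ?_, ?_⟩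
  · rw [sub_add_add_cancel, hsum]
  · rw [integral_sub hg₀i (integrable_const c)]
    simp [hc]
  · calc ∫⁻ ω, ‖g₀ (ξ ω) - c‖ₑ ^ 2 ∂P
        ≤ ∫⁻ ω, (2 * ‖g₀ (ξ ω)‖ₑ ^ 2 + 2 * ‖c‖ₑ ^ 2) ∂P := by
          refine lintegral_mono fun ω => ?_
          simp only [← ofReal_norm]
          rw [← ENNReal.ofReal_pow (norm_nonneg _), ← ENNReal.ofReal_pow (norm_nonneg _),
            ← ENNReal.ofReal_pow (norm_nonneg _), ← ENNReal.ofReal_ofNat,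
            ← ENNReal.ofReal_mul (by norm_num), ← ENNReal.ofReal_mul (by norm_num),
            ← ENNReal.ofReal_add (by positivity) (by positivity)]
          refine ENNReal.ofReal_le_ofReal ?_
          have := norm_sub_le (g₀ (ξ ω)) c
          nlinarith [sq_nonneg (‖g₀ (ξ ω)‖ - ‖c‖), norm_nonneg (g₀ (ξ ω) - c)]
      _ ≤ 4 * ∫⁻ ω, ‖g₀ (ξ ω)‖ₑ ^ 2 ∂P := by
          rw [lintegral_add_right _ measurable_const, lintegral_const,
            lintegral_const_mul' _ _ (by norm_num)]
          simp only [measure_univ, mul_one]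
          calc _ ≤ 2 * ∫⁻ ω, ‖g₀ (ξ ω)‖ₑ ^ 2 ∂P + 2 * ∫⁻ ω, ‖g₀ (ξ ω)‖ₑ ^ 2 ∂P := by gcongr
            _ = _ := by rw [← add_mul]; norm_num
      _ ≤ 4 * ENNReal.ofReal (2 * (K * y ^ (2 - α) / (2 - α))) := by gcongr
      _ = _ := by
          rw [← ENNReal.ofReal_ofNat, ← ENNReal.ofReal_mul (by norm_num)]
          congr 1
          ring
  · have hcH : ‖c‖ₑ ≤ ∫⁻ ω, ‖h₀ (ξ ω)‖ₑ ∂P := by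
      rw [← enorm_neg, ← hch]
      exact enorm_integral_le_lintegral_enorm _
    calc ∫⁻ ω, ‖h₀ (ξ ω) + c‖ₑ ∂P ≤ ∫⁻ ω, (‖h₀ (ξ ω)‖ₑ + ‖c‖ₑ) ∂P :=
          lintegral_mono fun ω => enorm_add_le _ _
      _ ≤ 2 * ∫⁻ ω, ‖h₀ (ξ ω)‖ₑ ∂P := by
          rw [lintegral_add_right _ measurable_const, lintegral_const, measure_univ, mul_one, two_mul]
          gcongr
      _ ≤ 2 * ENNReal.ofReal (K * (1 + 1 / (α - 1)) * y ^ (1 - α)) := by gcongr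
      _ = _ := by
          rw [← ENNReal.ofReal_ofNat, ← ENNReal.ofReal_mul (by norm_num)]
          congr 1
          ring

end Truncation

/-! ### Weak-type bounds for weighted sums of independent centered variables -/

section IndependentSums

variable {Ω ι : Type*} [MeasurableSpace Ω] {P : Measure Ω}

theorem indepFun_finsetSum_finsetSum {X : ι → Ω → ℂ} (hX : ∀ i, Measurable (X i))
    (hind : iIndepFun X P) {S T : Finset ι} (hST : Disjoint S T) :
    IndepFun (fun ω => ∑ i ∈ S, X i ω) (fun ω => ∑ i ∈ T, X i ω) P := by
  have h := hind.indepFun_finset S T hST hX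
  have hm : ∀ U : Finset ι, Measurable fun y : U → ℂ => ∑ i, y i := fun U => by fun_prop
  have h2 := h.comp (hm S) (hm T)
  have e : ∀ U : Finset ι, (fun y : U → ℂ => ∑ i, y i) ∘ (fun ω (i : U) => X i ω)
      = fun ω => ∑ i ∈ U, X i ω := fun U => by
    ext ω
    exact Finset.sum_coe_sort U fun i => X i ω
  rwa [e, e] at h2

variable [IsProbabilityMeasure P]

/-- The cross term is twice the real part of E U times the conjugate of E V, and V is centered. -/
theorem lintegral_enorm_add_sq_of_indepFun {U V : Ω → ℂ} (hU : MemLp U 2 P) (hV : MemLp V 2 P)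
    (hind : IndepFun U V P) (hmean : ∫ ω, V ω ∂P = 0) :
    ∫⁻ ω, ‖U ω + V ω‖ₑ ^ 2 ∂P = ∫⁻ ω, ‖U ω‖ₑ ^ 2 ∂P + ∫⁻ ω, ‖V ω‖ₑ ^ 2 ∂P := by
  have key : ∀ {W : Ω → ℂ}, MemLp W 2 P →
      ∫⁻ ω, ‖W ω‖ₑ ^ 2 ∂P = ENNReal.ofReal (∫ ω, ‖W ω‖ ^ 2 ∂P) := fun {W} hW => by
    rw [ofReal_integral_eq_lintegral_ofReal hW.integrable_norm_pow' (ae_of_all _ fun _ => by positivity)]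
    refine lintegral_congr fun ω => ?_
    rw [← ofReal_norm, ENNReal.ofReal_pow (norm_nonneg _)]
  have hU2 : Integrable (fun ω => ‖U ω‖ ^ 2) P := hU.integrable_norm_pow'
  have hV2 : Integrable (fun ω => ‖V ω‖ ^ 2) P := hV.integrable_norm_pow'
  have hVs : MemLp (fun ω => (starRingEnd ℂ) (V ω)) 2 P := hV.star
  have hUV : Integrable (fun ω => U ω * (starRingEnd ℂ) (V ω)) P := hU.integrable_mul hVs
  have hzero : ∫ ω, U ω * (starRingEnd ℂ) (V ω) ∂P = 0 := by
    have hi : IndepFun U (fun ω => (starRingEnd ℂ) (V ω)) P :=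
      hind.comp measurable_id (Complex.continuous_conj.measurable)
    rw [hi.integral_fun_mul_eq_mul_integral hU.1 hVs.1, integral_conj, hmean, map_zero, mul_zero]
  have hadd := key (hU.add hV)
  simp only [Pi.add_apply] at hadd
  rw [hadd, key hU, key hV, ← ENNReal.ofReal_add (integral_nonneg fun _ => by positivity)
    (integral_nonneg fun _ => by positivity)]
  congr 1
  have hexp : ∀ ω, ‖U ω + V ω‖ ^ 2
      = ‖U ω‖ ^ 2 + ‖V ω‖ ^ 2 + 2 * (U ω * (starRingEnd ℂ) (V ω)).re := fun ω => by
    simp only [Complex.sq_norm]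
    exact Complex.normSq_add _ _
  simp only [hexp]
  have hre : Integrable (fun ω => (U ω * (starRingEnd ℂ) (V ω)).re) P := hUV.re
  rw [integral_add (by exact hU2.add hV2) (hre.const_mul 2), integral_add hU2 hV2, integral_const_mul]
  have : ∫ ω, (U ω * (starRingEnd ℂ) (V ω)).re ∂P = 0 := by
    have := integral_re hUV
    simp only [RCLike.re_to_complex] at this
    rw [this, hzero, Complex.zero_re]
  rw [this, mul_zero, add_zero]

theorem lintegral_enorm_sum_sq_of_iIndepFun {X : ι → Ω → ℂ} (hX : ∀ i, Measurable (X i))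
    (hL2 : ∀ i, MemLp (X i) 2 P) (hind : iIndepFun X P) (hmean : ∀ i, ∫ ω, X i ω ∂P = 0)
    (s : Finset ι) :
    ∫⁻ ω, ‖∑ i ∈ s, X i ω‖ₑ ^ 2 ∂P = ∑ i ∈ s, ∫⁻ ω, ‖X i ω‖ₑ ^ 2 ∂P := by
  classical
  induction s using Finset.induction_on with
  | empty => simp
  | insert i s his ih =>
    simp_rw [Finset.sum_insert his]
    rw [← ih, ← lintegral_enorm_add_sq_of_indepFun (hL2 i) (memLp_finsetSum s fun j _ => hL2 j) ?_ ?_]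
    · have := indepFun_finsetSum_finsetSum hX hind (Finset.disjoint_singleton_left.2 his)
      simpa using this
    · rw [integral_finsetSum _ fun j _ => (hL2 j).integrable (by norm_num)]
      exact Finset.sum_eq_zero fun j _ => hmean j

theorem measure_lt_norm_sum_le_of_sq {ξ : ι → Ω → ℂ} (hξ : ∀ i, Measurable (ξ i))
    (hL2 : ∀ i, MemLp (ξ i) 2 P) (hind : iIndepFun ξ P) (hmean : ∀ i, ∫ ω, ξ i ω ∂P = 0) {K : ℝ}
    (hK : 0 ≤ K) (hbound : ∀ i, ∫⁻ ω, ‖ξ i ω‖ₑ ^ 2 ∂P ≤ ENNReal.ofReal K) (s : Finset ι) (a : ι → ℂ)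
    {x : ℝ} (hx : 0 < x) :
    P {ω | x < ‖∑ i ∈ s, a i * ξ i ω‖}
      ≤ ENNReal.ofReal (K * (∑ i ∈ s, ‖a i‖ ^ 2) / x ^ 2) := by
  have hX : ∀ i, Measurable fun ω => a i * ξ i ω := fun i => (hξ i).const_mul _
  have hsq : ∫⁻ ω, ‖∑ i ∈ s, a i * ξ i ω‖ₑ ^ 2 ∂P ≤ ENNReal.ofReal (K * (∑ i ∈ s, ‖a i‖ ^ 2)) := by
    rw [lintegral_enorm_sum_sq_of_iIndepFun (X := fun i ω => a i * ξ i ω) hX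
      (fun i => (hL2 i).const_mul _)
      (hind.comp (fun i z => a i * z) fun i => measurable_const_mul _)
      (fun i => by rw [integral_const_mul, hmean, mul_zero]),
      Finset.mul_sum, ENNReal.ofReal_sum_of_nonneg fun i _ => by positivity]
    refine Finset.sum_le_sum fun i _ => ?_
    simp only [enorm_mul, mul_pow]
    rw [lintegral_const_mul' _ _ (by simp), mul_comm, ENNReal.ofReal_mul hK,
      ENNReal.ofReal_pow (norm_nonneg _), ofReal_norm]
    gcongr
    exact hbound i
  have hsm : Measurable fun ω => ∑ i ∈ s, a i * ξ i ω := Finset.measurable_sum s fun i _ => hX i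
  calc P {ω | x < ‖∑ i ∈ s, a i * ξ i ω‖}
      ≤ P {ω | ENNReal.ofReal (x ^ 2) ≤ ‖∑ i ∈ s, a i * ξ i ω‖ₑ ^ 2} := by
        refine measure_mono fun ω hω => ?_
        have hω' : x < ‖∑ i ∈ s, a i * ξ i ω‖ := hω
        show ENNReal.ofReal (x ^ 2) ≤ ‖∑ i ∈ s, a i * ξ i ω‖ₑ ^ 2
        rw [← ofReal_norm, ← ENNReal.ofReal_pow (norm_nonneg _)]
        gcongr
    _ ≤ (∫⁻ ω, ‖∑ i ∈ s, a i * ξ i ω‖ₑ ^ 2 ∂P) / ENNReal.ofReal (x ^ 2) :=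
        meas_ge_le_lintegral_div (hsm.enorm.pow_const 2).aemeasurable (by simp; positivity) (by simp)
    _ ≤ _ := by
        rw [ENNReal.ofReal_div_of_pos (by positivity)]
        gcongr

/-- Each ξ_i is truncated at x / |a_i|, that is, a_i ξ_i at x. The bounded parts are handled by
orthogonality and Chebyshev, the tails by the triangle inequality and Markov, both at level x/2;
each yields a multiple of Σ|a_i|^α x^{-α}. -/
theorem exists_measure_lt_norm_sum_le {ξ : ι → Ω → ℂ} (hξ : ∀ i, Measurable (ξ i))
    (hint : ∀ i, Integrable (ξ i) P) (hind : iIndepFun ξ P) (hmean : ∀ i, ∫ ω, ξ i ω ∂P = 0)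
    {K α : ℝ} (hK : 0 ≤ K) (hα1 : 1 < α) (hα2 : α < 2)
    (htail : ∀ i t, 0 < t → P {ω | t < ‖ξ i ω‖} ≤ ENNReal.ofReal (K * t ^ (-α))) :
    ∃ C : ℝ, 0 ≤ C ∧ ∀ (s : Finset ι) (a : ι → ℂ) (x : ℝ), 0 < x →
      P {ω | x < ‖∑ i ∈ s, a i * ξ i ω‖}
        ≤ ENNReal.ofReal (C * (∑ i ∈ s, ‖a i‖ ^ α) * x ^ (-α)) := by
  have hα2' : 0 < 2 - α := by linarith
  have hα1' : 0 < α - 1 := by linarith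
  set C₁ : ℝ := 8 * K / (2 - α) with hC₁
  set C₂ : ℝ := 2 * K * (1 + 1 / (α - 1)) with hC₂
  have hC₁0 : 0 ≤ C₁ := by positivity
  have hC₂0 : 0 ≤ C₂ := by positivity
  -- The factors 4 and 2 come from dividing by (x/2)² and x/2.
  refine ⟨4 * C₁ + 2 * C₂, by positivity, fun s a x hx => ?_⟩
  -- When a_i = 0 the summand vanishes and any positive truncation level will do.
  set y : ι → ℝ := fun i => if a i = 0 then 1 else x / ‖a i‖ with hy
  have hy0 : ∀ i, 0 < y i := fun i => by
    simp only [hy]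
    split_ifs with h
    · exact one_pos
    · have := norm_pos_iff.2 h
      positivity
  -- Used with r = 2 for the bounded parts and r = 1 for the tails.
  have hay : ∀ i (r : ℝ), r ≠ 0 → ‖a i‖ ^ r * y i ^ (r - α) = ‖a i‖ ^ α * x ^ (r - α) := by
    intro i r hr
    simp only [hy]
    split_ifs with h
    · rw [h, norm_zero, Real.zero_rpow hr, Real.zero_rpow (by linarith), zero_mul, zero_mul]
    · have := norm_pos_iff.2 h
      rw [Real.div_rpow hx.le this.le, Real.rpow_sub this]
      field_simp
  choose g h hgm hhm hgh hg2 hg0 hgb hhb using fun i =>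
    exists_truncation (hξ i) (hint i) (hmean i) hK hα1 hα2 (htail i) (hy0 i)
  have hGm : Measurable fun ω => ∑ i ∈ s, a i * g i (ξ i ω) :=
    Finset.measurable_sum s fun i _ => ((hgm i).comp (hξ i)).const_mul _
  have hHm : Measurable fun ω => ∑ i ∈ s, a i * h i (ξ i ω) :=
    Finset.measurable_sum s fun i _ => ((hhm i).comp (hξ i)).const_mul _
  have hG : ∫⁻ ω, ‖∑ i ∈ s, a i * g i (ξ i ω)‖ₑ ^ 2 ∂P
      ≤ ENNReal.ofReal (C₁ * (∑ i ∈ s, ‖a i‖ ^ α) * x ^ (2 - α)) := by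
    rw [lintegral_enorm_sum_sq_of_iIndepFun (X := fun i ω => a i * g i (ξ i ω))
      (fun i => ((hgm i).comp (hξ i)).const_mul _) (fun i => (hg2 i).const_mul _)
      (hind.comp (fun i z => a i * g i z) fun i => (hgm i).const_mul _)
      (fun i => by rw [integral_const_mul, hg0, mul_zero]),
      Finset.mul_sum, Finset.sum_mul, ENNReal.ofReal_sum_of_nonneg fun i _ => by positivity]
    refine Finset.sum_le_sum fun i _ => ?_
    simp only [enorm_mul, mul_pow]
    rw [lintegral_const_mul' _ _ (by simp), mul_assoc, ← hay i 2 two_ne_zero, Real.rpow_two,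
      mul_left_comm, ENNReal.ofReal_mul (by positivity), ENNReal.ofReal_pow (norm_nonneg _),
      ofReal_norm]
    gcongr
    exact hgb i
  have hH : ∫⁻ ω, ‖∑ i ∈ s, a i * h i (ξ i ω)‖ₑ ∂P
      ≤ ENNReal.ofReal (C₂ * (∑ i ∈ s, ‖a i‖ ^ α) * x ^ (1 - α)) := by
    calc _ ≤ ∫⁻ ω, ∑ i ∈ s, ‖a i * h i (ξ i ω)‖ₑ ∂P := lintegral_mono fun ω => enorm_sum_le _ _
      _ = ∑ i ∈ s, ∫⁻ ω, ‖a i * h i (ξ i ω)‖ₑ ∂P :=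
        lintegral_finsetSum s fun i _ => (((hhm i).comp (hξ i)).const_mul _).enorm
      _ ≤ _ := by
        rw [Finset.mul_sum, Finset.sum_mul, ENNReal.ofReal_sum_of_nonneg fun i _ => by positivity]
        refine Finset.sum_le_sum fun i _ => ?_
        simp only [enorm_mul]
        rw [lintegral_const_mul' _ _ (by simp), mul_assoc, ← hay i 1 one_ne_zero, Real.rpow_one,
          mul_left_comm, ENNReal.ofReal_mul (norm_nonneg _), ofReal_norm]
        gcongr
        exact hhb i
  set S : ℝ := ∑ i ∈ s, ‖a i‖ ^ α with hS
  have hS0 : 0 ≤ S := Finset.sum_nonneg fun i _ => by positivity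
  calc P {ω | x < ‖∑ i ∈ s, a i * ξ i ω‖}
      ≤ P ({ω | ENNReal.ofReal ((x / 2) ^ 2) ≤ ‖∑ i ∈ s, a i * g i (ξ i ω)‖ₑ ^ 2}
          ∪ {ω | ENNReal.ofReal (x / 2) ≤ ‖∑ i ∈ s, a i * h i (ξ i ω)‖ₑ}) := by
        refine measure_mono fun ω hω => ?_
        have hω' : x < ‖∑ i ∈ s, a i * ξ i ω‖ := hω
        have hsplit : ∑ i ∈ s, a i * ξ i ω
            = ∑ i ∈ s, a i * g i (ξ i ω) + ∑ i ∈ s, a i * h i (ξ i ω) := by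
          rw [← Finset.sum_add_distrib]
          refine Finset.sum_congr rfl fun i _ => ?_
          rw [← mul_add, hgh]
        rw [hsplit] at hω'
        have := norm_add_le (∑ i ∈ s, a i * g i (ξ i ω)) (∑ i ∈ s, a i * h i (ξ i ω))
        by_cases hc : x / 2 ≤ ‖∑ i ∈ s, a i * g i (ξ i ω)‖
        · left
          show ENNReal.ofReal ((x / 2) ^ 2) ≤ ‖∑ i ∈ s, a i * g i (ξ i ω)‖ₑ ^ 2
          rw [← ofReal_norm, ← ENNReal.ofReal_pow (norm_nonneg _)]
          gcongr
        · right
          show ENNReal.ofReal (x / 2) ≤ ‖∑ i ∈ s, a i * h i (ξ i ω)‖ₑ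
          rw [← ofReal_norm]
          refine ENNReal.ofReal_le_ofReal ?_
          linarith
    _ ≤ (∫⁻ ω, ‖∑ i ∈ s, a i * g i (ξ i ω)‖ₑ ^ 2 ∂P) / ENNReal.ofReal ((x / 2) ^ 2)
        + (∫⁻ ω, ‖∑ i ∈ s, a i * h i (ξ i ω)‖ₑ ∂P) / ENNReal.ofReal (x / 2) := by
        refine (measure_union_le _ _).trans (add_le_add ?_ ?_)
        · exact meas_ge_le_lintegral_div (hGm.enorm.pow_const 2).aemeasurable
            (by simp; positivity) (by simp)
        · exact meas_ge_le_lintegral_div hHm.enorm.aemeasurable (by simp; positivity) (by simp)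
    _ ≤ ENNReal.ofReal (C₁ * S * x ^ (2 - α)) / ENNReal.ofReal ((x / 2) ^ 2)
        + ENNReal.ofReal (C₂ * S * x ^ (1 - α)) / ENNReal.ofReal (x / 2) := by gcongr
    _ = _ := by
        rw [← ENNReal.ofReal_div_of_pos (by positivity), ← ENNReal.ofReal_div_of_pos (by positivity),
          ← ENNReal.ofReal_add (by positivity) (by positivity)]
        congr 1
        rw [Real.rpow_sub hx, Real.rpow_sub hx, Real.rpow_neg hx.le, Real.rpow_two, Real.rpow_one]
        field_simp
        ring

end IndependentSums

/-! ### Khintchine's inequality by averaging over sign patterns -/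

section Khintchine

variable {ι : Type*} [DecidableEq ι]

/-- The sum of `x` with signs: `+` on `T`, `-` on `s \ T`. -/
def signedSum (x : ι → ℂ) (s T : Finset ι) : ℂ := ∑ i ∈ T, x i - ∑ i ∈ s \ T, x i

theorem signedSum_insert_left (x : ι → ℂ) {s T : Finset ι} {i : ι} (hi : i ∉ s) (hT : T ⊆ s) :
    signedSum x (insert i s) T = signedSum x s T - x i := by
  rw [signedSum, signedSum, Finset.insert_sdiff_of_notMem _ fun h => hi (hT h),
    Finset.sum_insert fun h => hi (Finset.sdiff_subset h)]
  ring

theorem signedSum_insert_insert (x : ι → ℂ) {s T : Finset ι} {i : ι} (hi : i ∉ s) (hT : T ⊆ s) :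
    signedSum x (insert i s) (insert i T) = signedSum x s T + x i := by
  have : insert i s \ insert i T = s \ T := by
    ext j
    simp only [Finset.mem_sdiff, Finset.mem_insert]
    have : j ∈ s → j ≠ i := fun hj h => hi (h ▸ hj)
    tauto
  rw [signedSum, signedSum, this, Finset.sum_insert fun h => hi (hT h)]
  ring

/-- The new index receives either sign, so averages over all sign patterns can be computed by
induction on the index set. -/
theorem sum_powerset_insert_signedSum (x : ι → ℂ) {s : Finset ι} {i : ι} (hi : i ∉ s)
    (F : ℂ → ℝ) :
    ∑ T ∈ (insert i s).powerset, F (signedSum x (insert i s) T)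
      = ∑ T ∈ s.powerset, (F (signedSum x s T - x i) + F (signedSum x s T + x i)) := by
  rw [Finset.sum_powerset_insert hi, Finset.sum_add_distrib]
  congr 1
  · exact Finset.sum_congr rfl fun T hT => by
      rw [signedSum_insert_left x hi (Finset.mem_powerset.1 hT)]
  · exact Finset.sum_congr rfl fun T hT => by
      rw [signedSum_insert_insert x hi (Finset.mem_powerset.1 hT)]

theorem norm_sub_sq_add_norm_add_sq (r x : ℂ) :
    ‖r - x‖ ^ 2 + ‖r + x‖ ^ 2 = 2 * ‖r‖ ^ 2 + 2 * ‖x‖ ^ 2 := by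
  have := parallelogram_law_with_norm ℝ r x
  nlinarith

/-- After expanding the squared norms, the terms linear in the inner product cancel and its square
is bounded by Cauchy–Schwarz. -/
theorem norm_sub_pow_four_add_norm_add_pow_four_le (r x : ℂ) :
    ‖r - x‖ ^ 4 + ‖r + x‖ ^ 4 ≤ 2 * ‖r‖ ^ 4 + 12 * ‖r‖ ^ 2 * ‖x‖ ^ 2 + 2 * ‖x‖ ^ 4 := by
  have h1 := norm_add_sq_real r x
  have h2 := norm_sub_sq_real r x
  have h3 := abs_real_inner_le_norm r x
  have h4 : (inner ℝ r x : ℝ) ^ 2 ≤ (‖r‖ * ‖x‖) ^ 2 := by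
    rw [← sq_abs]
    gcongr
  have e1 : ‖r - x‖ ^ 4 = (‖r - x‖ ^ 2) ^ 2 := by ring
  have e2 : ‖r + x‖ ^ 4 = (‖r + x‖ ^ 2) ^ 2 := by ring
  rw [e1, e2, h1, h2]
  nlinarith

theorem sum_powerset_norm_signedSum_sq (x : ι → ℂ) (s : Finset ι) :
    ∑ T ∈ s.powerset, ‖signedSum x s T‖ ^ 2 = 2 ^ s.card * ∑ i ∈ s, ‖x i‖ ^ 2 := by
  induction s using Finset.induction_on with
  | empty => simp [signedSum]
  | insert i s hi ih =>
    rw [sum_powerset_insert_signedSum x hi fun z => ‖z‖ ^ 2]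
    simp only [norm_sub_sq_add_norm_add_sq]
    rw [Finset.sum_add_distrib, ← Finset.mul_sum, ih, Finset.sum_const, Finset.card_powerset,
      Finset.card_insert_of_notMem hi, Finset.sum_insert hi, nsmul_eq_mul]
    push_cast
    ring

theorem sum_powerset_norm_signedSum_pow_four_le (x : ι → ℂ) (s : Finset ι) :
    ∑ T ∈ s.powerset, ‖signedSum x s T‖ ^ 4 ≤ 2 ^ s.card * (3 * (∑ i ∈ s, ‖x i‖ ^ 2) ^ 2) := by
  induction s using Finset.induction_on with
  | empty => simp [signedSum]
  | insert i s hi ih =>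
    rw [sum_powerset_insert_signedSum x hi fun z => ‖z‖ ^ 4]
    refine (Finset.sum_le_sum fun T _ =>
      norm_sub_pow_four_add_norm_add_pow_four_le (signedSum x s T) (x i)).trans ?_
    rw [Finset.sum_add_distrib, Finset.sum_add_distrib, ← Finset.mul_sum, ← Finset.sum_mul,
      ← Finset.mul_sum, sum_powerset_norm_signedSum_sq, Finset.sum_const, Finset.card_powerset,
      Finset.card_insert_of_notMem hi, Finset.sum_insert hi, nsmul_eq_mul]
    push_cast
    have : 0 ≤ (2 : ℝ) ^ s.card * ‖x i‖ ^ 4 := by positivity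
    ring_nf at ih this ⊢
    linarith

/-- Khintchine's inequality in `L¹`. -/
theorem sqrt_le_sum_powerset_norm_signedSum (x : ι → ℂ) (s : Finset ι) :
    2 ^ s.card * √(∑ i ∈ s, ‖x i‖ ^ 2) ≤ 4 * ∑ T ∈ s.powerset, ‖signedSum x s T‖ := by
  set S : ℝ := ∑ i ∈ s, ‖x i‖ ^ 2 with hS
  have hS0 : 0 ≤ S := Finset.sum_nonneg fun i _ => by positivity
  rcases hS0.eq_or_lt with h | h
  · rw [← h, Real.sqrt_zero, mul_zero]
    exact mul_nonneg (by norm_num) (Finset.sum_nonneg fun _ _ => norm_nonneg _)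
  set σ := √S with hσ
  have hσ0 : 0 < σ := Real.sqrt_pos.2 h
  have hσ2 : S = σ ^ 2 := (Real.sq_sqrt hS0).symm
  -- This pointwise inequality replaces interpolation between L¹, L² and L⁴. The mean of t² over the
  -- sign patterns is σ² and that of t⁴ is at most 3σ⁴, so averaging leaves 4σ⁴ - 3σ⁴ = σ⁴ on the
  -- left, against 4σ³ times the mean of t.
  have hpt : ∀ t : ℝ, 0 ≤ t → 4 * σ ^ 2 * t ^ 2 - t ^ 4 ≤ 4 * σ ^ 3 * t := by
    intro t ht
    have : 0 ≤ t * (4 * σ ^ 3 - 4 * σ ^ 2 * t + t ^ 3) := by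
      refine mul_nonneg ht ?_
      rcases le_total t (2 * σ) with h1 | h1
      · rcases le_total t σ with h2 | h2
        · nlinarith [pow_nonneg ht 3, mul_nonneg (sq_nonneg σ) (sub_nonneg.2 h2)]
        · nlinarith [mul_nonneg hσ0.le (sq_nonneg (2 * t - 2 * σ)), mul_nonneg ht (sq_nonneg (t - σ)),
            mul_nonneg hσ0.le (sq_nonneg (3 * t - 4 * σ)), mul_nonneg ht (sq_nonneg (3 * t - 4 * σ)),
            mul_nonneg ht (sq_nonneg (t - 2 * σ)), pow_pos hσ0 3]
      · nlinarith [mul_nonneg ht (sq_nonneg (t - 2 * σ)), pow_pos hσ0 3,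
          mul_nonneg (mul_nonneg ht (sub_nonneg.2 h1)) hσ0.le,
          mul_nonneg (mul_nonneg ht (sub_nonneg.2 h1)) ht]
    nlinarith
  have hsum := Finset.sum_le_sum (s := s.powerset)
    fun T _ => hpt ‖signedSum x s T‖ (norm_nonneg _)
  rw [Finset.sum_sub_distrib, ← Finset.mul_sum, ← Finset.mul_sum,
    sum_powerset_norm_signedSum_sq] at hsum
  have h4 := sum_powerset_norm_signedSum_pow_four_le x s
  rw [← hS, hσ2] at h4 hsum
  have : σ ^ 3 * (2 ^ s.card * σ) ≤ σ ^ 3 * (4 * ∑ T ∈ s.powerset, ‖signedSum x s T‖) := by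
    nlinarith
  exact le_of_mul_le_mul_left this (by positivity)

end Khintchine

/-! ### Lower bounds in L¹ for weighted sums of independent centered variables -/

section LowerBound

variable {Ω ι : Type*} [MeasurableSpace Ω] {P : Measure Ω} [IsProbabilityMeasure P]

/-- Jensen's inequality conditionally on U: for each fixed z, z is the mean of z + V. Independence
turns this into an iterated integral. -/
theorem lintegral_enorm_le_lintegral_enorm_add {U V : Ω → ℂ} (hU : Measurable U)
    (hV : Measurable V) (hVint : Integrable V P) (hind : IndepFun U V P)
    (hmean : ∫ ω, V ω ∂P = 0) : ∫⁻ ω, ‖U ω‖ₑ ∂P ≤ ∫⁻ ω, ‖U ω + V ω‖ₑ ∂P := by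
  have hprod := hind.map_prod_eq_prod_map_map hU.aemeasurable hV.aemeasurable
  have := Measure.isProbabilityMeasure_map (μ := P) hV.aemeasurable
  have hadd : Measurable fun z : ℂ × ℂ => ‖z.1 + z.2‖ₑ := by fun_prop
  calc ∫⁻ ω, ‖U ω‖ₑ ∂P = ∫⁻ z, ‖z‖ₑ ∂(P.map U) := by
        rw [lintegral_map (by fun_prop) hU]
    _ ≤ ∫⁻ z, ∫⁻ w, ‖z + w‖ₑ ∂(P.map V) ∂(P.map U) := by
        refine lintegral_mono fun z => ?_
        have hz : z = ∫ ω, (z + V ω) ∂P := by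
          rw [integral_add (integrable_const z) hVint, hmean]
          simp
        calc ‖z‖ₑ = ‖∫ ω, (z + V ω) ∂P‖ₑ := by rw [← hz]
          _ ≤ ∫⁻ ω, ‖z + V ω‖ₑ ∂P := enorm_integral_le_lintegral_enorm _
          _ = _ := by rw [lintegral_map (by fun_prop) hV]
    _ = ∫⁻ ω, ‖U ω + V ω‖ₑ ∂P := by
        rw [← lintegral_prod _ hadd.aemeasurable, ← hprod, lintegral_map hadd (hU.prodMk hV)]

theorem lintegral_enorm_sum_subset_le {X : ι → Ω → ℂ} (hX : ∀ i, Measurable (X i))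
    (hint : ∀ i, Integrable (X i) P) (hind : iIndepFun X P) (hmean : ∀ i, ∫ ω, X i ω ∂P = 0)
    {s T : Finset ι} (hT : T ⊆ s) :
    ∫⁻ ω, ‖∑ i ∈ T, X i ω‖ₑ ∂P ≤ ∫⁻ ω, ‖∑ i ∈ s, X i ω‖ₑ ∂P := by
  classical
  have hm : ∀ U : Finset ι, Measurable fun ω => ∑ i ∈ U, X i ω :=
    fun U => Finset.measurable_sum U fun i _ => hX i
  have := lintegral_enorm_le_lintegral_enorm_add (P := P) (hm T) (hm (s \ T))
    (integrable_finsetSum _ fun i _ => hint i)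
    (indepFun_finsetSum_finsetSum hX hind Finset.disjoint_sdiff)
    (by rw [integral_finsetSum _ fun i _ => hint i]; exact Finset.sum_eq_zero fun i _ => hmean i)
  refine this.trans (le_of_eq (lintegral_congr fun ω => ?_))
  rw [add_comm, Finset.sum_sdiff hT]

/-- The lower bound of the Marcinkiewicz–Zygmund inequality in `L¹`. -/
theorem lintegral_sqrt_sum_sq_le {X : ι → Ω → ℂ} (hX : ∀ i, Measurable (X i))
    (hint : ∀ i, Integrable (X i) P) (hind : iIndepFun X P) (hmean : ∀ i, ∫ ω, X i ω ∂P = 0)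
    (s : Finset ι) :
    ∫⁻ ω, ENNReal.ofReal (√(∑ i ∈ s, ‖X i ω‖ ^ 2)) ∂P ≤ 8 * ∫⁻ ω, ‖∑ i ∈ s, X i ω‖ₑ ∂P := by
  classical
  have hm : ∀ U : Finset ι, Measurable fun ω => ∑ i ∈ U, X i ω :=
    fun U => Finset.measurable_sum U fun i _ => hX i
  have h2 : (2 : ℝ≥0∞) ^ s.card ≠ 0 := by simp
  have h2' : (2 : ℝ≥0∞) ^ s.card ≠ ∞ := by simp
  rw [← ENNReal.mul_le_mul_iff_right h2 h2', ← lintegral_const_mul' _ _ h2']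
  -- Khintchine is applied for each ω. A signed sum is a difference of two subset sums, and each of
  -- these is dominated in L¹ by the full sum, so no symmetrization is needed; 8 is Khintchine's 4
  -- times 2.
  calc ∫⁻ ω, 2 ^ s.card * ENNReal.ofReal (√(∑ i ∈ s, ‖X i ω‖ ^ 2)) ∂P
      ≤ ∫⁻ ω, 4 * ∑ T ∈ s.powerset, (‖∑ i ∈ T, X i ω‖ₑ + ‖∑ i ∈ s \ T, X i ω‖ₑ) ∂P := by
        refine lintegral_mono fun ω => ?_
        have := sqrt_le_sum_powerset_norm_signedSum (fun i => X i ω) s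
        have := ENNReal.ofReal_le_ofReal this
        rw [ENNReal.ofReal_mul (by positivity), ENNReal.ofReal_mul (by norm_num),
          ENNReal.ofReal_sum_of_nonneg fun _ _ => norm_nonneg _,
          ENNReal.ofReal_pow (by norm_num), ENNReal.ofReal_ofNat, ENNReal.ofReal_ofNat] at this
        refine this.trans ?_
        gcongr with T hT
        rw [ofReal_norm, signedSum]
        exact enorm_sub_le
    _ = 4 * ∑ T ∈ s.powerset, (∫⁻ ω, ‖∑ i ∈ T, X i ω‖ₑ ∂P + ∫⁻ ω, ‖∑ i ∈ s \ T, X i ω‖ₑ ∂P) := by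
        rw [lintegral_const_mul' _ _ (by norm_num),
          lintegral_finsetSum _ fun T _ => by
            have := (hm T).enorm
            have := (hm (s \ T)).enorm
            fun_prop]
        congr 1
        refine Finset.sum_congr rfl fun T _ => ?_
        rw [lintegral_add_left (hm T).enorm]
    _ ≤ 4 * ∑ T ∈ s.powerset, (∫⁻ ω, ‖∑ i ∈ s, X i ω‖ₑ ∂P + ∫⁻ ω, ‖∑ i ∈ s, X i ω‖ₑ ∂P) := by
        refine mul_le_mul_right (Finset.sum_le_sum fun T hT => add_le_add ?_ ?_) _
        · exact lintegral_enorm_sum_subset_le hX hint hind hmean (Finset.mem_powerset.1 hT)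
        · exact lintegral_enorm_sum_subset_le hX hint hind hmean Finset.sdiff_subset
    _ = _ := by
        rw [Finset.sum_const, Finset.card_powerset, nsmul_eq_mul, ← two_mul]
        push_cast
        ring

/-- With S = Σ|a_i|², Cauchy–Schwarz gives Σ|a_i|²|ξ_i| ≤ √S · √(Σ|a_i ξ_i|²). The expectation of
the left side is at least κ S, and dividing by √S leaves κ√S. -/
theorem le_lintegral_enorm_sum_of_le_lintegral_enorm {ξ : ι → Ω → ℂ} (hξ : ∀ i, Measurable (ξ i))
    (hint : ∀ i, Integrable (ξ i) P) (hind : iIndepFun ξ P) (hmean : ∀ i, ∫ ω, ξ i ω ∂P = 0)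
    {κ : ℝ} (hκ : 0 ≤ κ) (hbound : ∀ i, ENNReal.ofReal κ ≤ ∫⁻ ω, ‖ξ i ω‖ₑ ∂P)
    (s : Finset ι) (a : ι → ℂ) :
    ENNReal.ofReal (κ * √(∑ i ∈ s, ‖a i‖ ^ 2)) ≤ 8 * ∫⁻ ω, ‖∑ i ∈ s, a i * ξ i ω‖ₑ ∂P := by
  refine le_trans ?_ (lintegral_sqrt_sum_sq_le (X := fun i ω => a i * ξ i ω)
    (fun i => (hξ i).const_mul _) (fun i => (hint i).const_mul _)
    (hind.comp (fun i z => a i * z) fun i => measurable_const_mul _)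
    (fun i => by rw [integral_const_mul, hmean, mul_zero]) s)
  set S : ℝ := ∑ i ∈ s, ‖a i‖ ^ 2 with hS
  have hS0 : 0 ≤ S := Finset.sum_nonneg fun i _ => by positivity
  rcases hS0.eq_or_lt with h | h
  · simp [← h]
  have hσ : 0 < √S := Real.sqrt_pos.2 h
  have hne : ENNReal.ofReal (√S) ≠ 0 := by simpa using h
  rw [← ENNReal.mul_le_mul_iff_right hne ENNReal.ofReal_ne_top,
    ← lintegral_const_mul' _ _ ENNReal.ofReal_ne_top]
  calc ENNReal.ofReal √S * ENNReal.ofReal (κ * √S)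
      = ∑ i ∈ s, ENNReal.ofReal (‖a i‖ ^ 2) * ENNReal.ofReal κ := by
        rw [← Finset.sum_mul, ← ENNReal.ofReal_sum_of_nonneg fun i _ => by positivity, ← hS,
          ← ENNReal.ofReal_mul hσ.le, ← ENNReal.ofReal_mul hS0]
        congr 1
        nlinarith [Real.mul_self_sqrt hS0]
    _ ≤ ∑ i ∈ s, ENNReal.ofReal (‖a i‖ ^ 2) * ∫⁻ ω, ‖ξ i ω‖ₑ ∂P := by
        gcongr with i hi
        exact hbound i
    _ = ∫⁻ ω, ∑ i ∈ s, ENNReal.ofReal (‖a i‖ ^ 2) * ‖ξ i ω‖ₑ ∂P := by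
        rw [lintegral_finsetSum _ fun i _ => (hξ i).enorm.const_mul _]
        exact Finset.sum_congr rfl fun i _ => (lintegral_const_mul' _ _ ENNReal.ofReal_ne_top).symm
    _ ≤ _ := by
        refine lintegral_mono fun ω => ?_
        simp only [← ofReal_norm, ← ENNReal.ofReal_mul (sq_nonneg ‖a _‖)]
        rw [← ENNReal.ofReal_sum_of_nonneg fun i _ => by positivity, ← ENNReal.ofReal_mul hσ.le]
        refine ENNReal.ofReal_le_ofReal ?_
        have := Real.sum_mul_le_sqrt_mul_sqrt s (fun i => ‖a i‖) (fun i => ‖a i * ξ i ω‖)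
        refine le_trans (le_of_eq (Finset.sum_congr rfl fun i _ => ?_)) this
        rw [norm_mul]
        ring

/-- The square function dominates the largest |a_i ξ_i|, which by independence exceeds a multiple of
the ℓ^α norm of a with probability bounded below. -/
theorem le_lintegral_enorm_sum_of_tail {ξ : ι → Ω → ℂ} (hξ : ∀ i, Measurable (ξ i))
    (hint : ∀ i, Integrable (ξ i) P) (hind : iIndepFun ξ P) (hmean : ∀ i, ∫ ω, ξ i ω ∂P = 0)
    {c x₀ α : ℝ} (hα : 0 < α) (hc : 0 < c) (hx₀ : 0 < x₀)
    (htail : ∀ i t, x₀ ≤ t → c * t ^ (-α) ≤ P.real {ω | t < ‖ξ i ω‖})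
    (s : Finset ι) (a : ι → ℂ) :
    ENNReal.ofReal (x₀ * (1 - Real.exp (-(c * x₀ ^ (-α)))) * (∑ i ∈ s, ‖a i‖ ^ α) ^ (1 / α))
      ≤ 8 * ∫⁻ ω, ‖∑ i ∈ s, a i * ξ i ω‖ₑ ∂P := by
  have hX : ∀ i, Measurable fun ω => a i * ξ i ω := fun i => (hξ i).const_mul _
  have hXind := hind.comp (fun i z => a i * z) fun i => measurable_const_mul _
  refine le_trans ?_ (lintegral_sqrt_sum_sq_le (X := fun i ω => a i * ξ i ω)
    hX (fun i => (hint i).const_mul _) hXind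
    (fun i => by rw [integral_const_mul, hmean, mul_zero]) s)
  set S : ℝ := ∑ i ∈ s, ‖a i‖ ^ α with hS
  have hS0 : 0 ≤ S := Finset.sum_nonneg fun i _ => by positivity
  rcases hS0.eq_or_lt with h | h
  · rw [← h, Real.zero_rpow (one_div_pos.2 hα).ne', mul_zero, ENNReal.ofReal_zero]
    exact zero_le
  set σ := S ^ (1 / α) with hσ
  have hσ0 : 0 < σ := Real.rpow_pos_of_pos h _
  have hσS : σ ^ α = S := by
    rw [hσ, ← Real.rpow_mul hS0, one_div_mul_cancel hα.ne', Real.rpow_one]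
  -- Since |a_i| ≤ σ, this choice gives x / |a_i| ≥ x₀, so the tail bound applies to every index
  -- with a_i ≠ 0.
  set x := x₀ * σ with hx
  have hx0 : 0 < x := by positivity
  set A : Set Ω := ⋂ i ∈ s, (fun ω => a i * ξ i ω) ⁻¹' {z | ‖z‖ ≤ x} with hA
  have hball : MeasurableSet {z : ℂ | ‖z‖ ≤ x} := measurableSet_le measurable_norm measurable_const
  have hAm : MeasurableSet A := Finset.measurableSet_biInter s fun i _ => hX i hball
  -- From 1 - t ≤ e^{-t}. The exponents are proportional to |a_i|^α / S and add up to -c x₀^{-α},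
  -- whatever the weights.
  have hi : ∀ i ∈ s, P.real ((fun ω => a i * ξ i ω) ⁻¹' {z | ‖z‖ ≤ x})
      ≤ Real.exp (-(c * x₀ ^ (-α) * (‖a i‖ ^ α / S))) := by
    intro i his
    rcases eq_or_ne (a i) 0 with h0 | h0
    · rw [h0, norm_zero, Real.zero_rpow hα.ne', zero_div, mul_zero, neg_zero, Real.exp_zero]
      exact measureReal_le_one
    · have ha : 0 < ‖a i‖ := norm_pos_iff.2 h0
      have haσ : ‖a i‖ ≤ σ := by
        rw [← Real.rpow_le_rpow_iff ha.le hσ0.le hα, hσS]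
        exact Finset.single_le_sum (f := fun i => ‖a i‖ ^ α) (fun j _ => by positivity) his
      have ht : x₀ ≤ x / ‖a i‖ := by
        rw [le_div_iff₀ ha]
        exact mul_le_mul_of_nonneg_left haσ hx₀.le
      have hcompl : (fun ω => a i * ξ i ω) ⁻¹' {z | ‖z‖ ≤ x} = {ω | x / ‖a i‖ < ‖ξ i ω‖}ᶜ := by
        ext ω
        show ‖a i * ξ i ω‖ ≤ x ↔ ¬ (x / ‖a i‖ < ‖ξ i ω‖)
        rw [not_lt, le_div_iff₀ ha, norm_mul, mul_comm]
      rw [hcompl, probReal_compl_eq_one_sub (measurableSet_lt measurable_const (hξ i).norm)]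
      have h1 := htail i _ ht
      have h2 := Real.add_one_le_exp (-(c * x₀ ^ (-α) * (‖a i‖ ^ α / S)))
      have h3 : c * (x / ‖a i‖) ^ (-α) = c * x₀ ^ (-α) * (‖a i‖ ^ α / S) := by
        rw [hx, Real.div_rpow hx0.le ha.le, Real.mul_rpow hx₀.le hσ0.le, Real.rpow_neg hσ0.le,
          Real.rpow_neg ha.le, hσS]
        field_simp
      linarith
  have hPA : P.real A ≤ Real.exp (-(c * x₀ ^ (-α))) := by
    have hprod := hXind.measure_inter_preimage_eq_mul s (sets := fun _ => {z | ‖z‖ ≤ x})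
      fun i _ => hball
    have : P.real A = ∏ i ∈ s, P.real ((fun ω => a i * ξ i ω) ⁻¹' {z | ‖z‖ ≤ x}) := by
      simp only [measureReal_def]
      rw [← ENNReal.toReal_prod]
      exact congrArg _ hprod
    rw [this]
    refine (Finset.prod_le_prod (fun i _ => measureReal_nonneg) hi).trans (le_of_eq ?_)
    rw [← Real.exp_sum, Finset.sum_neg_distrib, ← Finset.mul_sum, ← Finset.sum_div, ← hS,
      div_self h.ne', mul_one]
  calc _ ≤ ENNReal.ofReal x * P Aᶜ := by
        rw [← ofReal_measureReal, ← ENNReal.ofReal_mul hx0.le, probReal_compl_eq_one_sub hAm]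
        refine ENNReal.ofReal_le_ofReal ?_
        rw [hx, mul_right_comm]
        gcongr
    _ = ∫⁻ ω, Aᶜ.indicator (fun _ => ENNReal.ofReal x) ω ∂P := by
        rw [lintegral_indicator_const hAm.compl]
    _ ≤ _ := by
        refine lintegral_mono fun ω => ?_
        by_cases hω : ω ∈ Aᶜ
        swap
        · rw [Set.indicator_of_notMem hω]
          exact zero_le
        rw [Set.indicator_of_mem hω]
        simp only [hA, Set.mem_compl_iff, Set.mem_iInter, not_forall] at hω
        obtain ⟨i, his, hω⟩ := hω
        have hω' : ¬ ‖a i * ξ i ω‖ ≤ x := hω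
        refine ENNReal.ofReal_le_ofReal (Real.le_sqrt_of_sq_le ?_)
        calc x ^ 2 ≤ ‖a i * ξ i ω‖ ^ 2 := by
              have := (not_le.1 hω').le
              gcongr
          _ ≤ _ := Finset.single_le_sum (f := fun i => ‖a i * ξ i ω‖ ^ 2)
              (fun j _ => by positivity) his

end LowerBound

/-! ### Independent random coefficients -/

section RandomCoefficients

variable {Ω ι : Type*} [MeasurableSpace Ω] {P : Measure Ω} [IsProbabilityMeasure P]

/-- Fubini: the coefficients may be frozen, so that bounds for deterministic weights apply inside
the outer integral. -/
theorem lintegral_comp_sum_mul_of_indepFun {A ξ : ι → Ω → ℂ} (hA : ∀ i, Measurable (A i))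
    (hξ : ∀ i, Measurable (ξ i)) {s : Finset ι}
    (hind : IndepFun (fun ω (i : s) => A i ω) (fun ω (i : s) => ξ i ω) P) {F : ℂ → ℝ≥0∞}
    (hF : Measurable F) :
    ∫⁻ ω, F (∑ i ∈ s, A i ω * ξ i ω) ∂P = ∫⁻ ω, ∫⁻ ω', F (∑ i ∈ s, A i ω * ξ i ω') ∂P ∂P := by
  have hAm : Measurable fun ω (i : s) => A i ω := measurable_pi_lambda _ fun i => hA i
  have hξm : Measurable fun ω (i : s) => ξ i ω := measurable_pi_lambda _ fun i => hξ i
  have hprod := hind.map_prod_eq_prod_map_map hAm.aemeasurable hξm.aemeasurable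
  have := Measure.isProbabilityMeasure_map (μ := P) hξm.aemeasurable
  have hsum : ∀ ω ω', ∑ i ∈ s, A i ω * ξ i ω' = ∑ i : s, A i ω * ξ i ω' := fun ω ω' =>
    (Finset.sum_coe_sort s fun i => A i ω * ξ i ω').symm
  have hΦ : Measurable fun z : (s → ℂ) × (s → ℂ) => F (∑ i, z.1 i * z.2 i) :=
    hF.comp (by fun_prop)
  simp only [hsum]
  calc _ = ∫⁻ z, F (∑ i, z.1 i * z.2 i) ∂(P.map fun ω => (fun i : s => A i ω, fun i : s => ξ i ω)) := by
        rw [lintegral_map hΦ (hAm.prodMk hξm)]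
    _ = ∫⁻ a, ∫⁻ x, F (∑ i, a i * x i) ∂(P.map fun ω (i : s) => ξ i ω) ∂(P.map fun ω (i : s) => A i ω) := by
        rw [hprod, lintegral_prod _ hΦ.aemeasurable]
    _ = _ := by
        rw [lintegral_map hΦ.lintegral_prod_right' hAm]
        refine lintegral_congr fun ω => ?_
        exact lintegral_map (hΦ.comp measurable_prodMk_left) hξm

/-- Weak-type bounds for deterministic coefficients give `L^p` bounds for independent random ones. -/
theorem lintegral_norm_sum_rpow_le {A ξ : ι → Ω → ℂ} (hA : ∀ i, Measurable (A i))
    (hξ : ∀ i, Measurable (ξ i)) {s : Finset ι}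
    (hind : IndepFun (fun ω (i : s) => A i ω) (fun ω (i : s) => ξ i ω) P) {C p α : ℝ} (hC : 0 ≤ C)
    (hp : 0 < p) (hpα : p < α)
    (hweak : ∀ (a : ι → ℂ) (x : ℝ), 0 < x → P {ω | x < ‖∑ i ∈ s, a i * ξ i ω‖}
      ≤ ENNReal.ofReal (C * (∑ i ∈ s, ‖a i‖ ^ α) * x ^ (-α))) {M : ℝ} (hM : 0 < M)
    (hmom : ∫⁻ ω, ENNReal.ofReal (∑ i ∈ s, ‖A i ω‖ ^ α) ∂P ≤ ENNReal.ofReal M) :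
    ∫⁻ ω, ‖∑ i ∈ s, A i ω * ξ i ω‖ₑ ^ p ∂P
      ≤ ENNReal.ofReal ((1 + C * (1 + p / (α - p))) * M ^ (p / α)) := by
  have hα : 0 < α := hp.trans hpα
  have hm : Measurable fun ω => ∑ i ∈ s, A i ω * ξ i ω :=
    Finset.measurable_sum s fun i _ => (hA i).mul (hξ i)
  have htail : ∀ t, 0 < t → P {ω | t < ‖∑ i ∈ s, A i ω * ξ i ω‖}
      ≤ ENNReal.ofReal (C * M * t ^ (-α)) := by
    intro t ht
    have hset : MeasurableSet {z : ℂ | t < ‖z‖} := measurableSet_lt measurable_const measurable_norm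
    have h1 := lintegral_comp_sum_mul_of_indepFun hA hξ hind
      (F := {z : ℂ | t < ‖z‖}.indicator 1) (measurable_one.indicator hset)
    have h2 : ∀ B : ι → Ω → ℂ, (∀ i, Measurable (B i)) →
        ∫⁻ ω, {z : ℂ | t < ‖z‖}.indicator 1 (∑ i ∈ s, B i ω * ξ i ω) ∂P
        = P {ω | t < ‖∑ i ∈ s, B i ω * ξ i ω‖} := fun B hB => by
      have hBm : Measurable fun ω => ∑ i ∈ s, B i ω * ξ i ω :=
        Finset.measurable_sum s fun i _ => (hB i).mul (hξ i)
      exact lintegral_indicator_one (hBm hset)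
    rw [h2 A hA] at h1
    rw [h1]
    calc _ ≤ ∫⁻ ω, ENNReal.ofReal (C * t ^ (-α)) * ENNReal.ofReal (∑ i ∈ s, ‖A i ω‖ ^ α) ∂P := by
          refine lintegral_mono fun ω => ?_
          rw [h2 (fun i _ => A i ω) fun i => measurable_const, ← ENNReal.ofReal_mul (by positivity)]
          refine (hweak (fun i => A i ω) t ht).trans (le_of_eq ?_)
          congr 1
          ring
      _ ≤ ENNReal.ofReal (C * t ^ (-α)) * ENNReal.ofReal M := by
          rw [lintegral_const_mul' _ _ ENNReal.ofReal_ne_top]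
          gcongr
      _ = _ := by
          rw [← ENNReal.ofReal_mul (by positivity)]
          congr 1
          ring
  -- This level balances the two contributions: y^p and M y^{p-α} both equal M^{p/α}.
  set y : ℝ := M ^ (1 / α) with hy
  have hy0 : 0 < y := Real.rpow_pos_of_pos hM _
  have h3 := lintegral_rpow_tail_le hm.norm (fun ω => norm_nonneg _) (by positivity) hp hpα htail hy0
  have hαp : 0 < α - p := by linarith
  calc _ ≤ ∫⁻ ω, (ENNReal.ofReal (y ^ p) + ENNReal.ofReal
          (({ω | y < ‖∑ i ∈ s, A i ω * ξ i ω‖}.indicator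
            (fun ω => ‖∑ i ∈ s, A i ω * ξ i ω‖) ω) ^ p)) ∂P := by
        refine lintegral_mono fun ω => ?_
        rw [← ofReal_norm, ENNReal.ofReal_rpow_of_nonneg (norm_nonneg _) hp.le]
        by_cases h : y < ‖∑ i ∈ s, A i ω * ξ i ω‖
        · rw [Set.indicator_of_mem (by exact h)]
          exact le_add_self
        · refine le_trans ?_ le_self_add
          have := not_lt.1 h
          gcongr
    _ ≤ ENNReal.ofReal (y ^ p) + ENNReal.ofReal (C * M * (1 + p / (α - p)) * y ^ (p - α)) := by
        rw [lintegral_add_left measurable_const, lintegral_const, measure_univ, mul_one]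
        gcongr
    _ = _ := by
        rw [← ENNReal.ofReal_add (by positivity) (by positivity)]
        congr 1
        rw [hy, ← Real.rpow_mul hM.le, ← Real.rpow_mul hM.le]
        have e : 1 / α * (p - α) = p / α - 1 := by field_simp
        rw [e, Real.rpow_sub hM, Real.rpow_one, one_div_mul_eq_div]
        field_simp

end RandomCoefficients

/-! ### Weights of individuals and the offspring Laplace transform -/

namespace BranchingRandomWalk

variable {Ω : Type*} [MeasurableSpace Ω] {P : Measure Ω} (B : BranchingRandomWalk P)

/-- The family of the individual `u`: number and displacements of its children. -/
def family (u : List ℕ) (ω : Ω) : ℕ∞ × (ℕ → ℝ) := (B.J u ω, fun i => B.X u i ω)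

theorem measurable_family (u : List ℕ) : Measurable (B.family u) :=
  (B.measurable_J u).prodMk (measurable_pi_lambda _ fun i => B.measurable_X u i)

/-- The contribution `e^{-z X_i}` of the child number `i` of a family; `0` if there is no such
child. -/
noncomputable def childWeight (z : ℂ) (i : ℕ) (y : ℕ∞ × (ℕ → ℝ)) : ℂ :=
  {y : ℕ∞ × (ℕ → ℝ) | (i : ℕ∞) < y.1}.indicator (fun y => Complex.exp (-z * y.2 i)) y

theorem measurable_childWeight (z : ℂ) (i : ℕ) : Measurable (childWeight z i) := by
  refine Measurable.indicator (by fun_prop) ?_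
  exact measurable_fst (MeasurableSet.of_discrete (s := {j : ℕ∞ | (i : ℕ∞) < j}))

theorem enorm_childWeight (z : ℂ) (i : ℕ) (y : ℕ∞ × (ℕ → ℝ)) :
    ‖childWeight z i y‖ₑ = ‖childWeight z.re i y‖ₑ := by
  rw [childWeight, childWeight]
  by_cases h : y ∈ {y : ℕ∞ × (ℕ → ℝ) | (i : ℕ∞) < y.1}
  · rw [Set.indicator_of_mem h, Set.indicator_of_mem h, ← ofReal_norm, ← ofReal_norm,
      Complex.norm_exp, Complex.norm_exp]
    simp
  · rw [Set.indicator_of_notMem h, Set.indicator_of_notMem h]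

theorem enorm_childWeight_rpow (t : ℝ) (i : ℕ) (y : ℕ∞ × (ℕ → ℝ)) {r : ℝ} (hr : 0 < r) :
    ‖childWeight t i y‖ₑ ^ r = ‖childWeight ((r * t : ℝ) : ℂ) i y‖ₑ := by
  rw [childWeight, childWeight]
  by_cases h : y ∈ {y : ℕ∞ × (ℕ → ℝ) | (i : ℕ∞) < y.1}
  · rw [Set.indicator_of_mem h, Set.indicator_of_mem h, ← ofReal_norm, ← ofReal_norm,
      Complex.norm_exp, Complex.norm_exp, ENNReal.ofReal_rpow_of_nonneg (Real.exp_nonneg _) hr.le,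
      ← Real.exp_mul]
    congr 2
    simp
    ring
  · rw [Set.indicator_of_notMem h, Set.indicator_of_notMem h, enorm_zero, ENNReal.zero_rpow_of_pos hr]

/-- The sum `∑_i e^{-z X_i}` over the children in a family. -/
noncomputable def childSum (z : ℂ) (y : ℕ∞ × (ℕ → ℝ)) : ℂ := ∑' i, childWeight z i y

theorem measurable_childSum (z : ℂ) : Measurable (childSum z) :=
  Measurable.tsum fun i => measurable_childWeight z i

/-- The weight `e^{-z S(u)}` of the individual `u`; `0` if `u` is not born. -/
noncomputable def weight (z : ℂ) : List ℕ → Ω → ℂ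
  | [], _ => 1
  | i :: u, ω => weight z u ω * childWeight z i (B.family u ω)

-- The factor of a missing child is zero, so the product along the ancestral line also records
-- whether the individual is born.
open Classical in
theorem weight_eq (z : ℂ) (u : List ℕ) (ω : Ω) :
    B.weight z u ω = if B.Born u ω then Complex.exp (-z * B.position u ω) else 0 := by
  induction u with
  | nil => simp [weight, Born, position]
  | cons i u ih =>
    rw [weight, ih, childWeight]
    have hborn : B.Born (i :: u) ω ↔ B.Born u ω ∧ (i : ℕ∞) < B.J u ω := Iff.rfl
    simp only [hborn]
    by_cases h1 : B.Born u ω <;> by_cases h2 : (i : ℕ∞) < B.J u ω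
    · rw [if_pos h1, Set.indicator_of_mem (by exact h2), if_pos ⟨h1, h2⟩, ← Complex.exp_add]
      simp only [family, position]
      congr 1
      push_cast
      ring
    · rw [Set.indicator_of_notMem (by exact h2), mul_zero]
      simp [h2]
    · simp [h1]
    · simp [h1]

theorem generation_indicator (z : ℂ) (n : ℕ) (u : List ℕ) (ω : Ω) :
    (B.generation n ω).indicator (fun u => Complex.exp (-z * B.position u ω)) u
      = if u.length = n then B.weight z u ω else 0 := by
  classical
  rw [weight_eq]
  by_cases h1 : u.length = n <;> by_cases h2 : B.Born u ω
  · rw [Set.indicator_of_mem (by exact ⟨h1, h2⟩), if_pos h1, if_pos h2]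
  · rw [Set.indicator_of_notMem (by exact fun h => h2 h.2), if_pos h1, if_neg h2]
  · rw [Set.indicator_of_notMem (by exact fun h => h1 h.1), if_neg h1]
  · rw [Set.indicator_of_notMem (by exact fun h => h1 h.1), if_neg h1]

theorem biggins_eq (n : ℕ) (z : ℂ) (ω : Ω) :
    B.biggins n z ω
      = (B.laplace z ^ n)⁻¹ * ∑' u : List ℕ, if u.length = n then B.weight z u ω else 0 := by
  simp only [biggins, generation_indicator]

theorem measurable_weight (z : ℂ) (u : List ℕ) : Measurable (B.weight z u) := by
  induction u with
  | nil => exact measurable_const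
  | cons i u ih => exact ih.mul ((measurable_childWeight z i).comp (B.measurable_family u))

theorem measurable_biggins (n : ℕ) (z : ℂ) : Measurable (B.biggins n z) := by
  have : B.biggins n z = fun ω =>
      (B.laplace z ^ n)⁻¹ * ∑' u : List ℕ, if u.length = n then B.weight z u ω else 0 :=
    funext fun ω => B.biggins_eq n z ω
  rw [this]
  refine Measurable.const_mul (Measurable.tsum fun u => ?_) _
  split_ifs
  · exact B.measurable_weight z u
  · exact measurable_const

theorem enorm_weight (z : ℂ) (u : List ℕ) (ω : Ω) :
    ‖B.weight z u ω‖ₑ = ‖B.weight z.re u ω‖ₑ := by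
  induction u with
  | nil => rfl
  | cons i u ih => rw [weight, weight, enorm_mul, enorm_mul, ih, enorm_childWeight]

/-- This is where the parameter αθ enters: α-th powers of the weights at θ are the weights at αθ. -/
theorem enorm_weight_rpow (t : ℝ) (u : List ℕ) (ω : Ω) {r : ℝ} (hr : 0 < r) :
    ‖B.weight t u ω‖ₑ ^ r = ‖B.weight ((r * t : ℝ) : ℂ) u ω‖ₑ := by
  induction u with
  | nil => simp [weight]
  | cons i u ih =>
    rw [weight, weight, enorm_mul, enorm_mul, ENNReal.mul_rpow_of_nonneg _ _ hr.le, ih,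
      enorm_childWeight_rpow _ _ _ hr]

theorem identDistrib_family (u : List ℕ) : IdentDistrib (B.family u) (B.family []) P P :=
  B.identDistrib u

theorem iIndepFun_family : iIndepFun B.family P := B.indep

/-- Resolving the intensity by child number turns integrals against it into sums of expectations
over single children. -/
theorem intensity_eq_sum : B.intensity
    = Measure.sum fun i : ℕ => (P.restrict {ω | (i : ℕ∞) < B.J [] ω}).map (B.X [] i) := by
  have hJ : ∀ i : ℕ, MeasurableSet {ω | (i : ℕ∞) < B.J [] ω} := fun i =>
    B.measurable_J [] (MeasurableSet.of_discrete (s := {j : ℕ∞ | (i : ℕ∞) < j}))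
  ext s hs
  rw [B.intensity_apply hs, Measure.sum_apply _ hs]
  simp only [offspring, Measure.sum_apply _ hs]
  have hpt : ∀ (i : ℕ) (ω : Ω), ({ω' | (i : ℕ∞) < B.J [] ω'}.indicator
      (fun ω' => Measure.dirac (B.X [] i ω')) ω) s
      = ((B.X [] i ⁻¹' s) ∩ {ω | (i : ℕ∞) < B.J [] ω}).indicator 1 ω := by
    intro i ω
    by_cases h : ω ∈ {ω | (i : ℕ∞) < B.J [] ω}
    · rw [Set.indicator_of_mem h, Measure.dirac_apply' _ hs]
      by_cases h2 : B.X [] i ω ∈ s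
      · rw [Set.indicator_of_mem h2, Set.indicator_of_mem (by exact ⟨h2, h⟩)]
        rfl
      · rw [Set.indicator_of_notMem h2, Set.indicator_of_notMem (by exact fun h' => h2 h'.1)]
    · rw [Set.indicator_of_notMem h, Set.indicator_of_notMem (by exact fun h' => h h'.2)]
      rfl
  simp only [hpt]
  have hm : ∀ i, MeasurableSet ((B.X [] i ⁻¹' s) ∩ {ω | (i : ℕ∞) < B.J [] ω}) := fun i =>
    (B.measurable_X [] i hs).inter (hJ i)
  rw [lintegral_tsum fun i => (measurable_one.indicator (hm i)).aemeasurable]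
  refine tsum_congr fun i => ?_
  rw [lintegral_indicator_one (hm i), Measure.map_apply (B.measurable_X [] i) hs,
    Measure.restrict_apply (B.measurable_X [] i hs)]

theorem lintegral_childWeight (t : ℝ) (i : ℕ) :
    ∫⁻ ω, ‖childWeight t i (B.family [] ω)‖ₑ ∂P
      = ∫⁻ x, ENNReal.ofReal (Real.exp (-t * x))
          ∂(P.restrict {ω | (i : ℕ∞) < B.J [] ω}).map (B.X [] i) := by
  have hJ : MeasurableSet {ω | (i : ℕ∞) < B.J [] ω} :=
    B.measurable_J [] (MeasurableSet.of_discrete (s := {j : ℕ∞ | (i : ℕ∞) < j}))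
  rw [lintegral_map (by fun_prop) (B.measurable_X [] i), ← lintegral_indicator hJ]
  refine lintegral_congr fun ω => ?_
  rw [childWeight]
  by_cases h : ω ∈ {ω | (i : ℕ∞) < B.J [] ω}
  · rw [Set.indicator_of_mem h, Set.indicator_of_mem (by exact h), ← ofReal_norm, Complex.norm_exp]
    simp [family]
  · rw [Set.indicator_of_notMem h, Set.indicator_of_notMem (by exact h), enorm_zero]

theorem lintegral_tsum_childWeight {t : ℝ} (ht : B.LaplaceFinite t) (u : List ℕ) :
    ∫⁻ ω, ∑' i, ‖childWeight t i (B.family u ω)‖ₑ ∂P = ENNReal.ofReal (B.laplaceReal t) := by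
  have hm : Measurable fun y => ∑' i, ‖childWeight t i y‖ₑ :=
    Measurable.tsum fun i => (measurable_childWeight t i).enorm
  have h1 : ∫⁻ ω, ∑' i, ‖childWeight t i (B.family u ω)‖ₑ ∂P
      = ∫⁻ ω, ∑' i, ‖childWeight t i (B.family [] ω)‖ₑ ∂P :=
    ((B.identDistrib_family u).comp hm).lintegral_eq
  have hmeas : ∀ i, Measurable fun ω => ‖childWeight t i (B.family [] ω)‖ₑ := fun i =>
    ((measurable_childWeight t i).comp (B.measurable_family [])).enorm
  rw [h1, lintegral_tsum fun i => (hmeas i).aemeasurable]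
  simp only [lintegral_childWeight]
  rw [← lintegral_sum_measure, ← B.intensity_eq_sum, laplaceReal,
    ofReal_integral_eq_lintegral_ofReal ht (ae_of_all _ fun _ => (Real.exp_pos _).le)]

theorem lintegral_tsum_childWeight_re {z : ℂ} (hz : B.LaplaceFinite z.re) (u : List ℕ) :
    ∫⁻ ω, ∑' i, ‖childWeight z i (B.family u ω)‖ₑ ∂P = ENNReal.ofReal (B.laplaceReal z.re) := by
  simp only [enorm_childWeight z]
  exact B.lintegral_tsum_childWeight hz u

theorem integral_childSum {z : ℂ} (hz : B.LaplaceFinite z.re) (u : List ℕ) :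
    ∫ ω, childSum z (B.family u ω) ∂P = B.laplace z := by
  have h1 : ∫ ω, childSum z (B.family u ω) ∂P = ∫ ω, childSum z (B.family [] ω) ∂P :=
    ((B.identDistrib_family u).comp (measurable_childSum z)).integral_eq
  have hmeas : ∀ i, Measurable fun ω => childWeight z i (B.family [] ω) := fun i =>
    (measurable_childWeight z i).comp (B.measurable_family [])
  have hint : Integrable (fun x : ℝ => Complex.exp (-z * x)) B.intensity := by
    refine Integrable.mono' hz (Measurable.aestronglyMeasurable (by fun_prop)) (ae_of_all _ fun x => ?_)
    rw [Complex.norm_exp]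
    simp
  rw [h1, laplace]
  simp only [childSum]
  rw [integral_tsum (fun i => (hmeas i).aestronglyMeasurable)]
  · rw [intensity_eq_sum] at hint ⊢
    rw [integral_sum_measure hint]
    refine tsum_congr fun i => ?_
    have hJ : MeasurableSet {ω | (i : ℕ∞) < B.J [] ω} :=
      B.measurable_J [] (MeasurableSet.of_discrete (s := {j : ℕ∞ | (i : ℕ∞) < j}))
    rw [integral_map (B.measurable_X [] i).aemeasurable
      (Measurable.aestronglyMeasurable (by fun_prop)), ← integral_indicator hJ]
    rfl
  · rw [← lintegral_tsum fun i => (hmeas i).enorm.aemeasurable, B.lintegral_tsum_childWeight_re hz]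
    exact ENNReal.ofReal_ne_top

end BranchingRandomWalk

/-! ### Sums over generations and the martingale increments -/

theorem tsum_ite_length_succ {E : Type*} [AddCommMonoid E] [TopologicalSpace E] (f : List ℕ → E)
    (n : ℕ) : ∑' v : List ℕ, (if v.length = n + 1 then f v else 0)
      = ∑' p : List ℕ × ℕ, if p.1.length = n then f (p.2 :: p.1) else 0 := by
  have hinj : Function.Injective fun p : List ℕ × ℕ => p.2 :: p.1 := by
    rintro ⟨u, i⟩ ⟨v, j⟩ h
    simp only [List.cons.injEq] at h
    rw [h.1, h.2]
  rw [← hinj.tsum_eq]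
  · simp
  · intro v hv
    rcases v with _ | ⟨i, u⟩
    · simp at hv
    · exact ⟨(u, i), rfl⟩

theorem tsum_ite_length_zero {E : Type*} [AddCommMonoid E] [TopologicalSpace E]
    (f : List ℕ → E) : ∑' v : List ℕ, (if v.length = 0 then f v else 0) = f [] := by
  rw [tsum_eq_single []]
  · simp
  · intro v hv
    rw [if_neg fun h => hv (List.length_eq_zero_iff.1 h)]

theorem tsum_ite_length_one {E : Type*} [AddCommMonoid E] [TopologicalSpace E]
    (f : List ℕ → E) : ∑' v : List ℕ, (if v.length = 1 then f v else 0) = ∑' i : ℕ, f [i] := by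
  have hinj : Function.Injective fun i : ℕ => [i] := List.singleton_injective
  rw [← hinj.tsum_eq]
  · simp
  · intro v hv
    by_cases h : v.length = 1
    · obtain ⟨i, rfl⟩ := List.length_eq_one_iff.1 h
      exact ⟨i, rfl⟩
    · simp [h] at hv

namespace BranchingRandomWalk

variable {Ω : Type*} [MeasurableSpace Ω] {P : Measure Ω} (B : BranchingRandomWalk P)

/-- The σ-algebra generated by the families of the individuals of the generations below `n`. -/
@[reducible] def past (n : ℕ) : MeasurableSpace Ω :=
  ⨆ v ∈ {v : List ℕ | v.length < n}, MeasurableSpace.comap (B.family v) inferInstance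

/-- The σ-algebra generated by the families of the individuals of the generation `n`. -/
@[reducible] def present (n : ℕ) : MeasurableSpace Ω :=
  ⨆ v ∈ {v : List ℕ | v.length = n}, MeasurableSpace.comap (B.family v) inferInstance

theorem measurable_family_past {v : List ℕ} {n : ℕ} (hv : v.length < n) :
    Measurable[B.past n] (B.family v) :=
  (comap_measurable (B.family v)).mono (le_iSup₂_of_le v hv le_rfl) le_rfl

theorem measurable_family_present {v : List ℕ} {n : ℕ} (hv : v.length = n) :
    Measurable[B.present n] (B.family v) :=
  (comap_measurable (B.family v)).mono (le_iSup₂_of_le v hv le_rfl) le_rfl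

theorem indep_past_present (n : ℕ) : Indep (B.past n) (B.present n) P := by
  refine indep_iSup_of_disjoint (fun v => (B.measurable_family v).comap_le) B.iIndepFun_family.iIndep ?_
  rw [Set.disjoint_left]
  intro v h1 h2
  have h1' : v.length < n := h1
  have h2' : v.length = n := h2
  omega

theorem indepFun_past_present {β γ : Type*} [MeasurableSpace β] [MeasurableSpace γ] {n : ℕ}
    {f : Ω → β} {g : Ω → γ} (hf : Measurable[B.past n] f) (hg : Measurable[B.present n] g) :
    IndepFun f g P := by
  rw [IndepFun_iff_Indep]
  exact indep_of_indep_of_le_left (indep_of_indep_of_le_right (B.indep_past_present n) hg.comap_le)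
    hf.comap_le

theorem measurable_weight_past (z : ℂ) {u : List ℕ} {n : ℕ} (hu : u.length ≤ n) :
    Measurable[B.past n] (B.weight z u) := by
  induction u with
  | nil => exact measurable_const
  | cons i u ih =>
    rw [List.length_cons] at hu
    exact (ih (by omega)).mul ((measurable_childWeight z i).comp (B.measurable_family_past (by omega)))

/-- Induction on the generation: the weight of u depends only on families of earlier generations,
hence is independent of the family of u, whose expected child sum is m(t). -/
theorem lintegral_tsum_weight [IsProbabilityMeasure P] {t : ℝ} (ht : B.LaplaceFinite t) (n : ℕ) :
    ∫⁻ ω, ∑' u : List ℕ, (if u.length = n then ‖B.weight t u ω‖ₑ else 0) ∂P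
      = ENNReal.ofReal (B.laplaceReal t) ^ n := by
  induction n with
  | zero => simp [weight]
  | succ n ih =>
    have hw : ∀ u : List ℕ, Measurable fun ω => if u.length = n then ‖B.weight t u ω‖ₑ else 0 := by
      intro u
      split_ifs
      · exact (B.measurable_weight t u).enorm
      · exact measurable_const
    have hc : ∀ u : List ℕ, Measurable fun ω => ∑' i, ‖childWeight t i (B.family u ω)‖ₑ := fun u =>
      Measurable.tsum fun i => ((measurable_childWeight t i).comp (B.measurable_family u)).enorm
    have hpt : ∀ ω, ∑' v : List ℕ, (if v.length = n + 1 then ‖B.weight t v ω‖ₑ else 0)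
        = ∑' u : List ℕ, (if u.length = n then ‖B.weight t u ω‖ₑ else 0)
          * ∑' i, ‖childWeight t i (B.family u ω)‖ₑ := by
      intro ω
      rw [tsum_ite_length_succ (fun v => ‖B.weight t v ω‖ₑ), ENNReal.tsum_prod']
      refine tsum_congr fun u => ?_
      rw [← ENNReal.tsum_mul_left]
      refine tsum_congr fun i => ?_
      simp only [weight, enorm_mul, ite_mul, zero_mul]
    simp only [hpt]
    have hwc : ∀ u : List ℕ, Measurable fun ω => (if u.length = n then ‖B.weight t u ω‖ₑ else 0)
        * ∑' i, ‖childWeight t i (B.family u ω)‖ₑ := fun u => (hw u).mul (hc u)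
    rw [lintegral_tsum fun u => (hwc u).aemeasurable, pow_succ, ← ih,
      lintegral_tsum fun u => (hw u).aemeasurable, ← ENNReal.tsum_mul_right]
    refine tsum_congr fun u => ?_
    by_cases hu : u.length = n
    · simp only [if_pos hu]
      rw [← B.lintegral_tsum_childWeight ht u]
      refine lintegral_mul_eq_lintegral_mul_lintegral_of_indepFun (B.measurable_weight t u).enorm
        (hc u) (B.indepFun_past_present (n := n) ?_ ?_)
      · exact measurable_enorm.comp (B.measurable_weight_past t hu.le)
      · have : Measurable fun y => ∑' i, ‖childWeight t i y‖ₑ :=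
          Measurable.tsum fun i => (measurable_childWeight t i).enorm
        exact this.comp (B.measurable_family_present hu)
    · simp [hu]

/-- The normalized weight `e^{-z S(u)} / m(z)^n` of an individual of the generation `n`. -/
noncomputable def coef (z : ℂ) (n : ℕ) (u : List ℕ) (ω : Ω) : ℂ :=
  if u.length = n then (B.laplace z ^ n)⁻¹ * B.weight z u ω else 0

/-- The copy of `Z_1(z) - 1` belonging to the individual `u`. -/
noncomputable def innov (z : ℂ) (u : List ℕ) (ω : Ω) : ℂ :=
  (B.laplace z)⁻¹ * childSum z (B.family u ω) - 1

theorem biggins_eq_tsum_coef (n : ℕ) (z : ℂ) (ω : Ω) :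
    B.biggins n z ω = ∑' u, B.coef z n u ω := by
  rw [biggins_eq, ← tsum_mul_left]
  simp only [coef, mul_ite, mul_zero]

theorem biggins_one (z : ℂ) (ω : Ω) : B.biggins 1 z ω = B.innov z [] ω + 1 := by
  rw [biggins_eq, tsum_ite_length_one, innov, pow_one, sub_add_cancel, childSum]
  simp only [weight, one_mul]

theorem biggins_zero (z : ℂ) (ω : Ω) : B.biggins 0 z ω = 1 := by
  rw [biggins_eq, tsum_ite_length_zero]
  simp [weight]

theorem measurable_coef (z : ℂ) (n : ℕ) (u : List ℕ) : Measurable (B.coef z n u) := by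
  unfold coef
  split_ifs
  · exact (B.measurable_weight z u).const_mul _
  · exact measurable_const

theorem measurable_coef_past (z : ℂ) (n : ℕ) (u : List ℕ) :
    Measurable[B.past n] (B.coef z n u) := by
  unfold coef
  split_ifs with h
  · exact (B.measurable_weight_past z h.le).const_mul _
  · exact measurable_const

theorem measurable_innov (z : ℂ) (u : List ℕ) : Measurable (B.innov z u) :=
  (((measurable_childSum z).comp (B.measurable_family u)).const_mul _).sub_const 1

theorem measurable_innov_present (z : ℂ) {n : ℕ} {u : List ℕ} (hu : u.length = n) :
    Measurable[B.present n] (B.innov z u) :=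
  (((measurable_childSum z).comp (B.measurable_family_present hu)).const_mul _).sub_const 1

theorem measurable_innovMap (z : ℂ) : Measurable fun y => (B.laplace z)⁻¹ * childSum z y - 1 :=
  ((measurable_childSum z).const_mul _).sub_const 1

theorem iIndepFun_innov (z : ℂ) : iIndepFun (B.innov z) P :=
  B.iIndepFun_family.comp (fun _ y => (B.laplace z)⁻¹ * childSum z y - 1)
    fun _ => B.measurable_innovMap z

theorem identDistrib_innov (z : ℂ) (u : List ℕ) :
    IdentDistrib (B.innov z u) (B.innov z []) P P :=
  (B.identDistrib_family u).comp (B.measurable_innovMap z)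

theorem integrable_childSum {z : ℂ} (hz : B.LaplaceFinite z.re) (u : List ℕ) :
    Integrable (fun ω => childSum z (B.family u ω)) P := by
  refine ⟨((measurable_childSum z).comp (B.measurable_family u)).aestronglyMeasurable, ?_⟩
  calc ∫⁻ ω, ‖childSum z (B.family u ω)‖ₑ ∂P
      ≤ ∫⁻ ω, ∑' i, ‖childWeight z i (B.family u ω)‖ₑ ∂P :=
        lintegral_mono fun ω => enorm_tsum_le_tsum_enorm
    _ < ∞ := by
        rw [B.lintegral_tsum_childWeight_re hz]
        exact ENNReal.ofReal_lt_top

theorem indepFun_coef_innov (z : ℂ) {n : ℕ} {s : Finset (List ℕ)} (hs : ∀ u ∈ s, u.length = n) :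
    IndepFun (fun ω (u : s) => B.coef z n u ω) (fun ω (u : s) => B.innov z u ω) P :=
  B.indepFun_past_present (n := n)
    (@measurable_pi_lambda _ _ _ (B.past n) _ _ fun u => B.measurable_coef_past z n u)
    (@measurable_pi_lambda _ _ _ (B.present n) _ _
      fun u => B.measurable_innov_present z (hs u u.2))

theorem tsum_enorm_coef_rpow {z : ℂ} {r : ℝ} (hr : 0 < r) (h0 : B.laplace z ≠ 0) (n : ℕ) (ω : Ω) :
    ∑' u, ‖B.coef z n u ω‖ₑ ^ r = ENNReal.ofReal ((‖B.laplace z‖ ^ r) ^ n)⁻¹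
      * ∑' u : List ℕ, if u.length = n then ‖B.weight ((r * z.re : ℝ) : ℂ) u ω‖ₑ else 0 := by
  rw [← ENNReal.tsum_mul_left]
  refine tsum_congr fun u => ?_
  unfold coef
  split_ifs with h
  · rw [enorm_mul, ENNReal.mul_rpow_of_nonneg _ _ hr.le, enorm_weight, enorm_weight_rpow _ _ _ _ hr]
    congr 1
    rw [← ofReal_norm, ENNReal.ofReal_rpow_of_nonneg (norm_nonneg _) hr.le]
    congr 1
    rw [norm_inv, norm_pow, Real.inv_rpow (by positivity), ← Real.rpow_natCast, ← Real.rpow_natCast,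
      ← Real.rpow_mul (norm_nonneg _), ← Real.rpow_mul (norm_nonneg _), mul_comm]
  · rw [enorm_zero, ENNReal.zero_rpow_of_pos hr, mul_zero]

theorem laplaceReal_nonneg (t : ℝ) : 0 ≤ B.laplaceReal t :=
  integral_nonneg fun _ => (Real.exp_pos _).le

theorem measurable_tsum_coef (z : ℂ) (n : ℕ) : Measurable fun ω => ∑' u, ‖B.coef z n u ω‖ₑ :=
  Measurable.tsum fun u => (B.measurable_coef z n u).enorm

theorem laplaceReal_pos {z : ℂ} (h0 : B.laplace z ≠ 0) {t : ℝ} (ht : B.LaplaceFinite t) :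
    0 < B.laplaceReal t := by
  have : NeZero B.intensity := ⟨fun h => h0 (by rw [laplace, h, integral_zero_measure])⟩
  exact integral_exp_pos ht

theorem coef_ofReal (t : ℝ) (n : ℕ) (u : List ℕ) (ω : Ω) :
    B.coef t n u ω = ((‖B.coef t n u ω‖ : ℝ) : ℂ) := by
  classical
  unfold coef
  split_ifs
  · rw [laplace_ofReal, weight_eq]
    split_ifs
    · have : (((B.laplaceReal t : ℂ) ^ n)⁻¹ * Complex.exp (-(t : ℂ) * B.position u ω))
          = (((B.laplaceReal t ^ n)⁻¹ * Real.exp (-t * B.position u ω) : ℝ) : ℂ) := by push_cast; rfl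
      rw [this, Complex.norm_real, Real.norm_of_nonneg]
      have := B.laplaceReal_nonneg t
      positivity
    · simp
  · simp

/-- Both sides are multiples of the sum of e^{-r Re(z) S(u)} over generation n; changing the
normalization from |m(z)|^r to m(r Re z) produces the n-th power in front. -/
theorem tsum_coef_rpow_eq {z : ℂ} {r : ℝ} (hr : 0 < r) (hz : B.LaplaceFinite (r * z.re))
    (h0 : B.laplace z ≠ 0) (n : ℕ) (ω : Ω) :
    ∑' u, ‖B.coef z n u ω‖ₑ ^ r
      = ENNReal.ofReal ((B.laplaceReal (r * z.re) / ‖B.laplace z‖ ^ r) ^ n)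
        * ∑' u, ‖B.coef ((r * z.re : ℝ) : ℂ) n u ω‖ₑ := by
  have hpos := B.laplaceReal_pos h0 hz
  have h1 : B.laplace ((r * z.re : ℝ) : ℂ) ≠ 0 := by
    rw [laplace_ofReal]
    exact_mod_cast hpos.ne'
  have h2 := B.tsum_enorm_coef_rpow one_pos h1 n ω
  simp only [ENNReal.rpow_one, Complex.ofReal_re, one_mul] at h2
  rw [B.tsum_enorm_coef_rpow hr h0, h2, ← mul_assoc, ← ENNReal.ofReal_mul (by positivity),
    laplace_ofReal, Complex.norm_real, Real.norm_of_nonneg hpos.le, Real.rpow_one, div_pow]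
  congr 2
  have := (pow_pos hpos n).ne'
  field_simp

variable [IsProbabilityMeasure P]

theorem integrable_innov {z : ℂ} (hz : B.LaplaceFinite z.re) (u : List ℕ) :
    Integrable (B.innov z u) P :=
  ((B.integrable_childSum hz u).const_mul _).sub (integrable_const 1)

theorem integral_innov {z : ℂ} (hz : B.LaplaceFinite z.re) (h0 : B.laplace z ≠ 0) (u : List ℕ) :
    ∫ ω, B.innov z u ω ∂P = 0 := by
  simp only [innov]
  rw [integral_sub ((B.integrable_childSum hz u).const_mul _) (integrable_const 1),
    integral_const_mul, B.integral_childSum hz, inv_mul_cancel₀ h0]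
  simp

theorem lintegral_tsum_coef {z : ℂ} {r : ℝ} (hr : 0 < r) (hz : B.LaplaceFinite (r * z.re))
    (h0 : B.laplace z ≠ 0) (n : ℕ) :
    ∫⁻ ω, ∑' u, ‖B.coef z n u ω‖ₑ ^ r ∂P
      = ENNReal.ofReal ((B.laplaceReal (r * z.re) / ‖B.laplace z‖ ^ r) ^ n) := by
  simp only [B.tsum_enorm_coef_rpow hr h0]
  rw [lintegral_const_mul' _ _ ENNReal.ofReal_ne_top, B.lintegral_tsum_weight hz,
    ← ENNReal.ofReal_pow (B.laplaceReal_nonneg _), ← ENNReal.ofReal_mul (by positivity), div_pow,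
    inv_mul_eq_div]

theorem lintegral_tsum_coef_one {z : ℂ} (hz : B.LaplaceFinite z.re) (h0 : B.laplace z ≠ 0) (n : ℕ) :
    ∫⁻ ω, ∑' u, ‖B.coef z n u ω‖ₑ ∂P
      = ENNReal.ofReal ((B.laplaceReal z.re / ‖B.laplace z‖) ^ n) := by
  have := B.lintegral_tsum_coef one_pos (z := z) (by rwa [one_mul]) h0 n
  simpa only [one_mul, ENNReal.rpow_one, Real.rpow_one] using this

theorem ae_tsum_coef_ne_top {z : ℂ} (hz : B.LaplaceFinite z.re) (h0 : B.laplace z ≠ 0) (n : ℕ) :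
    ∀ᵐ ω ∂P, ∑' u, ‖B.coef z n u ω‖ₑ ≠ ∞ := by
  have := ae_lt_top (B.measurable_tsum_coef z n)
    (by rw [B.lintegral_tsum_coef_one hz h0]; exact ENNReal.ofReal_ne_top)
  filter_upwards [this] with ω hω using hω.ne

theorem enorm_biggins_ofReal {t : ℝ} (ht : B.LaplaceFinite t) (h0 : B.laplace t ≠ 0) (n : ℕ) :
    ∀ᵐ ω ∂P, ‖B.biggins n t ω‖ₑ = ∑' u, ‖B.coef t n u ω‖ₑ := by
  filter_upwards [B.ae_tsum_coef_ne_top (z := t) (by simpa using ht) h0 n] with ω hω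
  have hs : Summable fun u => ‖B.coef t n u ω‖ := (Summable.of_enorm hω).norm
  have h1 : B.biggins n t ω = ((∑' u, ‖B.coef t n u ω‖ : ℝ) : ℂ) := by
    rw [biggins_eq_tsum_coef, Complex.ofReal_tsum]
    exact tsum_congr fun u => B.coef_ofReal t n u ω
  rw [h1, ← ofReal_norm, Complex.norm_real, Real.norm_of_nonneg (tsum_nonneg fun _ => norm_nonneg _),
    ENNReal.ofReal_tsum_of_nonneg (fun _ => norm_nonneg _) hs]
  simp only [ofReal_norm]

/-- Supplies the integrable majorant for passing from finite sums to the whole generation. By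
independence each term factorizes, and the first factors sum to (m(Re z)/|m(z)|)^n. -/
theorem lintegral_tsum_coef_innov {z : ℂ} (hz : B.LaplaceFinite z.re) (h0 : B.laplace z ≠ 0)
    (n : ℕ) : ∫⁻ ω, ∑' u, ‖B.coef z n u ω * B.innov z u ω‖ₑ ∂P ≠ ∞ := by
  have hm : ∀ u, Measurable fun ω => ‖B.coef z n u ω * B.innov z u ω‖ₑ := fun u =>
    ((B.measurable_coef z n u).mul (B.measurable_innov z u)).enorm
  rw [lintegral_tsum fun u => (hm u).aemeasurable]
  have h1 : ∀ u, ∫⁻ ω, ‖B.coef z n u ω * B.innov z u ω‖ₑ ∂P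
      = (∫⁻ ω, ‖B.coef z n u ω‖ₑ ∂P) * ∫⁻ ω, ‖B.innov z [] ω‖ₑ ∂P := by
    intro u
    have hid : ∫⁻ ω, ‖B.innov z u ω‖ₑ ∂P = ∫⁻ ω, ‖B.innov z [] ω‖ₑ ∂P :=
      ((B.identDistrib_innov z u).comp measurable_enorm).lintegral_eq
    by_cases hu : u.length = n
    · simp only [enorm_mul]
      rw [← hid]
      exact lintegral_mul_eq_lintegral_mul_lintegral_of_indepFun (B.measurable_coef z n u).enorm
        (B.measurable_innov z u).enorm (B.indepFun_past_present (n := n)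
          (measurable_enorm.comp (B.measurable_coef_past z n u))
          (measurable_enorm.comp (B.measurable_innov_present z hu)))
    · simp [coef, hu]
  simp only [h1]
  rw [ENNReal.tsum_mul_right, ← lintegral_tsum fun u => (B.measurable_coef z n u).enorm.aemeasurable,
    B.lintegral_tsum_coef_one hz h0]
  exact ENNReal.mul_ne_top ENNReal.ofReal_ne_top (B.integrable_innov hz []).2.ne

/-- Generation n + 1 is grouped by parents: the children of u contribute a_u times its normalized
child sum, and subtracting a_u leaves a_u ξ_u. -/
theorem hasSum_biggins_succ_sub {z : ℂ} (hz : B.LaplaceFinite z.re) (h0 : B.laplace z ≠ 0) (n : ℕ) :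
    ∀ᵐ ω ∂P, HasSum (fun u => B.coef z n u ω * B.innov z u ω)
      (B.biggins (n + 1) z ω - B.biggins n z ω) := by
  filter_upwards [B.ae_tsum_coef_ne_top hz h0 n, B.ae_tsum_coef_ne_top hz h0 (n + 1)] with ω h1 h2
  have hs1 : HasSum (fun u => B.coef z n u ω) (B.biggins n z ω) := by
    rw [biggins_eq_tsum_coef]
    exact (Summable.of_enorm h1).hasSum
  set F : List ℕ × ℕ → ℂ := fun p =>
    B.coef z n p.1 ω * (B.laplace z)⁻¹ * childWeight z p.2 (B.family p.1 ω) with hF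
  have hFeq : ∀ p : List ℕ × ℕ, (if p.1.length = n then
      (B.laplace z ^ (n + 1))⁻¹ * B.weight z (p.2 :: p.1) ω else 0) = F p := by
    rintro ⟨u, i⟩
    simp only [hF, coef, weight]
    split_ifs
    · rw [pow_succ, mul_inv]
      ring
    · simp
  have hb : B.biggins (n + 1) z ω = ∑' p, F p := by
    rw [biggins_eq_tsum_coef]
    simp only [coef]
    rw [tsum_ite_length_succ (fun v => (B.laplace z ^ (n + 1))⁻¹ * B.weight z v ω)]
    exact tsum_congr hFeq
  -- Absolute convergence over pairs (parent, child number) allows the children to be summed first.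
  have hFs : Summable F := by
    refine Summable.of_enorm ?_
    have : ∑' v, ‖B.coef z (n + 1) v ω‖ₑ = ∑' p, ‖F p‖ₑ := by
      have h := tsum_ite_length_succ (fun v => ‖(B.laplace z ^ (n + 1))⁻¹ * B.weight z v ω‖ₑ) n
      have e : ∀ v, ‖B.coef z (n + 1) v ω‖ₑ = if v.length = n + 1 then
          ‖(B.laplace z ^ (n + 1))⁻¹ * B.weight z v ω‖ₑ else 0 := fun v => by
        unfold coef
        split_ifs <;> simp
      simp only [e]
      rw [h]
      refine tsum_congr fun p => ?_
      rw [← hFeq p]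
      split_ifs <;> simp
    rwa [← this]
  have hs2 : HasSum (fun u => B.coef z n u ω * ((B.laplace z)⁻¹ * childSum z (B.family u ω)))
      (B.biggins (n + 1) z ω) := by
    rw [hb, hFs.tsum_prod]
    have e : (fun u => B.coef z n u ω * ((B.laplace z)⁻¹ * childSum z (B.family u ω)))
        = fun u => ∑' i, F (u, i) := by
      funext u
      simp only [hF]
      rw [tsum_mul_left, mul_assoc, childSum]
    rw [e]
    exact hFs.prod.hasSum
  have e : (fun u => B.coef z n u ω * B.innov z u ω) = fun u =>
      B.coef z n u ω * ((B.laplace z)⁻¹ * childSum z (B.family u ω)) - B.coef z n u ω := by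
    funext u
    rw [innov]
    ring
  rw [e]
  exact hs2.sub hs1

end BranchingRandomWalk

/-! ### Upper and lower bounds for the increments -/

theorem HasSum.tendsto_comp_finset {ι E : Type*} [AddCommMonoid E] [TopologicalSpace E] {f : ι → E}
    {a : E} (h : HasSum f a) {s : ℕ → Finset ι} (hs : Tendsto s atTop atTop) :
    Tendsto (fun N => ∑ i ∈ s N, f i) atTop (𝓝 a) := by
  rw [HasSum, SummationFilter.unconditional_filter] at h
  exact h.comp hs

section

variable {Ω : Type*} [MeasurableSpace Ω] {P : Measure Ω}

theorem convergesInLp_of_geometric {f : ℕ → Ω → ℂ} {p : ℝ} (hp : 1 ≤ p)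
    (hf : ∀ n, Measurable (f n)) (hf0 : MemLp (f 0) (ENNReal.ofReal p) P) {C r : ℝ≥0∞} (hC : C ≠ ∞)
    (hr : r < 1) (hbd : ∀ n, eLpNorm (fun ω => f (n + 1) ω - f n ω) (ENNReal.ofReal p) P ≤ C * r ^ n) :
    ConvergesInLp P f p := by
  have : Fact (1 ≤ ENNReal.ofReal p) := ⟨by simpa using hp⟩
  have hmem : ∀ n, MemLp (f n) (ENNReal.ofReal p) P := by
    intro n
    induction n with
    | zero => exact hf0
    | succ n ih =>
      have hd : MemLp (fun ω => f (n + 1) ω - f n ω) (ENNReal.ofReal p) P :=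
        ⟨((hf (n + 1)).sub (hf n)).aestronglyMeasurable, (hbd n).trans_lt
          (ENNReal.mul_lt_top hC.lt_top (ENNReal.pow_lt_top (hr.trans ENNReal.one_lt_top)))⟩
      have := hd.add ih
      convert this using 1
      ext ω
      simp
  have hcauchy : CauchySeq fun n => (hmem n).toLp (f n) := by
    refine cauchySeq_of_edist_le_geometric r C hr hC fun n => ?_
    rw [edist_comm, Lp.edist_toLp_toLp]
    exact hbd n
  obtain ⟨g, hg⟩ := cauchySeq_tendsto_of_complete hcauchy
  refine ⟨hmem, g, Lp.memLp g, ?_⟩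
  have h2 : g = (Lp.memLp g).toLp g := (Lp.toLp_coeFn g (Lp.memLp g)).symm
  rw [h2, Lp.tendsto_Lp_iff_tendsto_eLpNorm''] at hg
  exact hg

end

namespace BranchingRandomWalk

variable {Ω : Type*} [MeasurableSpace Ω] {P : Measure Ω} (B : BranchingRandomWalk P)

/-- Coefficients vanish outside generation n, so a finite set of words may be cut down to that
generation, where coefficients and innovations are independent. -/
theorem sum_filter_length_coef (z : ℂ) (n : ℕ) (s : Finset (List ℕ)) (ω : Ω) :
    ∑ u ∈ s.filter (fun u => u.length = n), B.coef z n u ω * B.innov z u ω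
      = ∑ u ∈ s, B.coef z n u ω * B.innov z u ω := by
  refine Finset.sum_filter_of_ne fun u _ h => ?_
  by_contra hu
  exact h (by simp [coef, hu])

variable [IsProbabilityMeasure P]

/-- The weak-type bound is integrated over the coefficients with E Σ|a_u|^α = q^n. It is uniform
over finite sets of individuals, and Fatou passes it to the whole generation. -/
theorem eLpNorm_biggins_succ_sub_le {z : ℂ} (hz : B.LaplaceFinite z.re) (h0 : B.laplace z ≠ 0)
    {C p α : ℝ} (hC : 0 ≤ C) (hp : 0 < p) (hpα : p < α) (hzα : B.LaplaceFinite (α * z.re))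
    (hweak : ∀ (s : Finset (List ℕ)) (a : List ℕ → ℂ) (x : ℝ), 0 < x →
      P {ω | x < ‖∑ u ∈ s, a u * B.innov z u ω‖}
        ≤ ENNReal.ofReal (C * (∑ u ∈ s, ‖a u‖ ^ α) * x ^ (-α))) (n : ℕ) :
    eLpNorm (fun ω => B.biggins (n + 1) z ω - B.biggins n z ω) (ENNReal.ofReal p) P
      ≤ ENNReal.ofReal ((1 + C * (1 + p / (α - p))) ^ (1 / p))
        * ENNReal.ofReal ((B.laplaceReal (α * z.re) / ‖B.laplace z‖ ^ α) ^ (1 / α)) ^ n := by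
  have hα : 0 < α := hp.trans hpα
  have hαp : 0 < α - p := by linarith
  set q : ℝ := B.laplaceReal (α * z.re) / ‖B.laplace z‖ ^ α with hq
  have hq0 : 0 < q := div_pos (B.laplaceReal_pos h0 hzα)
    (Real.rpow_pos_of_pos (norm_pos_iff.2 h0) _)
  set A : ℝ := 1 + C * (1 + p / (α - p)) with hA
  have hA0 : 0 ≤ A := by positivity
  obtain ⟨s, hs⟩ := exists_seq_tendsto (atTop : Filter (Finset (List ℕ)))
  have hm : ∀ N, Measurable fun ω => ∑ u ∈ s N, B.coef z n u ω * B.innov z u ω := fun N =>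
    Finset.measurable_sum _ fun u _ => (B.measurable_coef z n u).mul (B.measurable_innov z u)
  have hlim := Lp.eLpNorm_lim_le_liminf_eLpNorm (p := ENNReal.ofReal p) (μ := P)
    (fun N => (hm N).aestronglyMeasurable) (fun ω => B.biggins (n + 1) z ω - B.biggins n z ω) (by
      filter_upwards [B.hasSum_biggins_succ_sub hz h0 n] with ω hω
      exact hω.tendsto_comp_finset hs)
  refine hlim.trans (liminf_le_of_frequently_le' (Frequently.of_forall fun N => ?_))
  set T := (s N).filter fun u => u.length = n with hT
  have hTn : ∀ u ∈ T, u.length = n := fun u hu => (Finset.mem_filter.1 hu).2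
  have hmom : ∫⁻ ω, ENNReal.ofReal (∑ u ∈ T, ‖B.coef z n u ω‖ ^ α) ∂P ≤ ENNReal.ofReal (q ^ n) := by
    rw [hq, ← B.lintegral_tsum_coef hα hzα h0 n]
    refine lintegral_mono fun ω => ?_
    rw [ENNReal.ofReal_sum_of_nonneg fun u _ => by positivity]
    refine le_trans (le_of_eq (Finset.sum_congr rfl fun u _ => ?_)) (ENNReal.sum_le_tsum T)
    rw [← ofReal_norm, ENNReal.ofReal_rpow_of_nonneg (norm_nonneg _) hα.le]
  have hbd := lintegral_norm_sum_rpow_le (fun u => B.measurable_coef z n u)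
    (fun u => B.measurable_innov z u) (B.indepFun_coef_innov z hTn) hC hp hpα (hweak T)
    (pow_pos hq0 n) hmom
  simp only [hT, B.sum_filter_length_coef] at hbd
  rw [eLpNorm_eq_lintegral_rpow_enorm_toReal (by simpa using hp) ENNReal.ofReal_ne_top,
    ENNReal.toReal_ofReal hp.le]
  refine (ENNReal.rpow_le_rpow hbd (by positivity)).trans (le_of_eq ?_)
  rw [ENNReal.ofReal_rpow_of_nonneg (by positivity) (by positivity),
    ← ENNReal.ofReal_pow (by positivity), ← ENNReal.ofReal_mul (by positivity),
    Real.mul_rpow hA0 (by positivity)]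
  congr 2
  rw [← Real.rpow_natCast, ← Real.rpow_natCast, ← Real.rpow_mul hq0.le, ← Real.rpow_mul hq0.le,
    ← Real.rpow_mul hq0.le]
  congr 1
  field_simp

/-- The lower bound for fixed weights is averaged over the coefficients on finite sets of
individuals. In the limit, the left side is handled by Fatou and the right side by dominated
convergence. -/
theorem le_lintegral_biggins_succ_sub {z : ℂ} (hz : B.LaplaceFinite z.re) (h0 : B.laplace z ≠ 0)
    {c α : ℝ} (hc : 0 ≤ c) (hα : 0 < α)
    (hlow : ∀ (s : Finset (List ℕ)) (a : List ℕ → ℂ),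
      ENNReal.ofReal (c * (∑ u ∈ s, ‖a u‖ ^ α) ^ (1 / α))
        ≤ 8 * ∫⁻ ω, ‖∑ u ∈ s, a u * B.innov z u ω‖ₑ ∂P) (n : ℕ) :
    ENNReal.ofReal c * ∫⁻ ω, (∑' u, ‖B.coef z n u ω‖ₑ ^ α) ^ (1 / α) ∂P
      ≤ 8 * ∫⁻ ω, ‖B.biggins (n + 1) z ω - B.biggins n z ω‖ₑ ∂P := by
  obtain ⟨s, hs⟩ := exists_seq_tendsto (atTop : Filter (Finset (List ℕ)))
  have hm : ∀ N, Measurable fun ω => ∑ u ∈ s N, B.coef z n u ω * B.innov z u ω := fun N =>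
    Finset.measurable_sum _ fun u _ => (B.measurable_coef z n u).mul (B.measurable_innov z u)
  have hfin : ∀ N, ENNReal.ofReal c * ∫⁻ ω, (∑ u ∈ s N, ‖B.coef z n u ω‖ₑ ^ α) ^ (1 / α) ∂P
      ≤ 8 * ∫⁻ ω, ‖∑ u ∈ s N, B.coef z n u ω * B.innov z u ω‖ₑ ∂P := by
    intro N
    set T := (s N).filter fun u => u.length = n with hT
    have hTn : ∀ u ∈ T, u.length = n := fun u hu => (Finset.mem_filter.1 hu).2
    have h1 := lintegral_comp_sum_mul_of_indepFun (fun u => B.measurable_coef z n u)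
      (fun u => B.measurable_innov z u) (B.indepFun_coef_innov z hTn) measurable_enorm
    have h2 : ∀ ω, ∑ u ∈ s N, ‖B.coef z n u ω‖ₑ ^ α = ∑ u ∈ T, ‖B.coef z n u ω‖ₑ ^ α := by
      intro ω
      refine (Finset.sum_filter_of_ne fun u _ h => ?_).symm
      by_contra hu
      exact h (by simp [coef, hu, hα])
    simp only [← B.sum_filter_length_coef z n (s N), h2]
    rw [h1, ← lintegral_const_mul' _ _ ENNReal.ofReal_ne_top, ← lintegral_const_mul' _ _ (by norm_num)]
    refine lintegral_mono fun ω => le_trans (le_of_eq ?_) (hlow T fun u => B.coef z n u ω)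
    rw [ENNReal.ofReal_mul hc, ← ENNReal.ofReal_rpow_of_nonneg
      (Finset.sum_nonneg fun u _ => by positivity) (by positivity),
      ENNReal.ofReal_sum_of_nonneg fun u _ => by positivity]
    congr 2
    refine Finset.sum_congr rfl fun u _ => ?_
    rw [← ofReal_norm, ENNReal.ofReal_rpow_of_nonneg (norm_nonneg _) hα.le]
  have hR : Tendsto (fun N => ∫⁻ ω, ‖∑ u ∈ s N, B.coef z n u ω * B.innov z u ω‖ₑ ∂P) atTop
      (𝓝 (∫⁻ ω, ‖B.biggins (n + 1) z ω - B.biggins n z ω‖ₑ ∂P)) := by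
    refine tendsto_lintegral_of_dominated_convergence
      (fun ω => ∑' u, ‖B.coef z n u ω * B.innov z u ω‖ₑ) (fun N => (hm N).enorm)
      (fun N => ae_of_all _ fun ω => (enorm_sum_le _ _).trans (ENNReal.sum_le_tsum _))
      (B.lintegral_tsum_coef_innov hz h0 n) ?_
    filter_upwards [B.hasSum_biggins_succ_sub hz h0 n] with ω hω
    exact (hω.tendsto_comp_finset hs).enorm
  have hmc : ∀ N, Measurable fun ω => (∑ u ∈ s N, ‖B.coef z n u ω‖ₑ ^ α) ^ (1 / α) := fun N =>
    (Finset.measurable_sum _ fun u _ => (B.measurable_coef z n u).enorm.pow_const α).pow_const _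
  have hL : ∫⁻ ω, (∑' u, ‖B.coef z n u ω‖ₑ ^ α) ^ (1 / α) ∂P
      ≤ liminf (fun N => ∫⁻ ω, (∑ u ∈ s N, ‖B.coef z n u ω‖ₑ ^ α) ^ (1 / α) ∂P) atTop := by
    refine le_trans (le_of_eq (lintegral_congr fun ω => ?_)) (lintegral_liminf_le hmc)
    refine (Tendsto.liminf_eq ?_).symm
    exact ((ENNReal.continuous_rpow_const).tendsto _).comp
      (ENNReal.summable.hasSum.tendsto_comp_finset hs)
  have hR8 := ENNReal.Tendsto.const_mul (a := 8) hR (Or.inr (by norm_num))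
  refine le_trans (mul_le_mul_right hL _) ?_
  rw [← hR8.liminf_eq]
  refine le_trans (le_of_eq ?_) (liminf_le_liminf (Eventually.of_forall hfin))
  exact (ENNReal.liminf_const_mul_of_ne_top ENNReal.ofReal_ne_top).symm

end BranchingRandomWalk

/-! ### Consequences of the power tail of `Z_1` -/

section PowerTail

variable {Ω : Type*} [MeasurableSpace Ω] {P : Measure Ω} [IsProbabilityMeasure P]

theorem HasPowerTail.exists_upper {Y : Ω → ℂ} {α : ℝ} (h : HasPowerTail P Y α) (hα : 0 < α) :
    ∃ K : ℝ, 0 ≤ K ∧ ∀ t, 0 < t → P {ω | t < ‖Y ω - 1‖} ≤ ENNReal.ofReal (K * t ^ (-α)) := by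
  obtain ⟨b, hb1, hb2⟩ := exists_between h.2
  have hev := eventually_lt_of_limsup_lt hb1
  obtain ⟨x₀, hx₀⟩ := eventually_atTop.1 hev
  set x₁ : ℝ := max x₀ 2 with hx₁
  have hx₁2 : 2 ≤ x₁ := le_max_right _ _
  have hx₁0 : 0 < x₁ := by linarith
  -- The first term serves t ≥ 2x₁, where |Y - 1| > t forces |Y| > t/2; the second makes the bound
  -- at least 1 for t < 2x₁.
  refine ⟨b.toReal * 2 ^ α + (2 * x₁) ^ α, by positivity, fun t ht => ?_⟩
  have htα : 0 < t ^ α := Real.rpow_pos_of_pos ht _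
  rw [add_mul, Real.rpow_neg ht.le]
  rcases lt_or_ge t (2 * x₁) with h1 | h1
  · refine prob_le_one.trans ?_
    rw [← ENNReal.ofReal_one]
    refine ENNReal.ofReal_le_ofReal ?_
    have h2 : t ^ α ≤ (2 * x₁) ^ α := Real.rpow_le_rpow ht.le h1.le hα.le
    have h3 : 1 ≤ (2 * x₁) ^ α * (t ^ α)⁻¹ := by
      rw [← div_eq_mul_inv]
      exact (one_le_div htα).2 h2
    have : 0 ≤ b.toReal * 2 ^ α * (t ^ α)⁻¹ := by positivity
    linarith
  · have ht2 : x₀ ≤ t / 2 := by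
      have := le_max_left x₀ 2
      linarith
    have h2 := (hx₀ _ ht2).le
    have hpos : 0 < (t / 2) ^ α := Real.rpow_pos_of_pos (by linarith) _
    calc P {ω | t < ‖Y ω - 1‖} ≤ P {ω | t / 2 < ‖Y ω‖} := by
          refine measure_mono fun ω hω => ?_
          have hω' : t < ‖Y ω - 1‖ := hω
          have := norm_sub_le (Y ω) 1
          rw [norm_one] at this
          show t / 2 < ‖Y ω‖
          linarith
      _ ≤ b / ENNReal.ofReal ((t / 2) ^ α) := by
          rw [ENNReal.le_div_iff_mul_le (Or.inl (by simpa using hpos)) (Or.inl ENNReal.ofReal_ne_top),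
            mul_comm]
          exact h2
      _ = ENNReal.ofReal (b.toReal / (t / 2) ^ α) := by
          rw [ENNReal.ofReal_div_of_pos hpos, ENNReal.ofReal_toReal hb2.ne]
      _ ≤ _ := by
          refine ENNReal.ofReal_le_ofReal ?_
          rw [Real.div_rpow ht.le two_pos.le]
          have : 0 ≤ (2 * x₁) ^ α * (t ^ α)⁻¹ := by positivity
          have e : b.toReal / (t ^ α / 2 ^ α) = b.toReal * 2 ^ α * (t ^ α)⁻¹ := by
            have : (2 : ℝ) ^ α ≠ 0 := (Real.rpow_pos_of_pos two_pos _).ne'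
            field_simp
          linarith

theorem HasPowerTail.eventually_le {Y : Ω → ℂ} {α : ℝ} (h : HasPowerTail P Y α) :
    ∃ c : ℝ, 0 < c ∧ ∃ x₀ : ℝ, 0 < x₀ ∧ ∀ t, x₀ ≤ t → c * t ^ (-α) ≤ P.real {ω | t < ‖Y ω‖} := by
  obtain ⟨b, hb1, hb2⟩ := exists_between h.1
  have hev := eventually_lt_of_lt_liminf hb2
  obtain ⟨x₀, hx₀⟩ := eventually_atTop.1 hev
  have hbtop : b ≠ ∞ := hb2.ne_top
  refine ⟨b.toReal, ENNReal.toReal_pos hb1.ne' hbtop, max x₀ 1, by positivity, fun t ht => ?_⟩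
  have ht0 : 0 < t := one_pos.trans_le ((le_max_right _ _).trans ht)
  have htα : 0 < t ^ α := Real.rpow_pos_of_pos ht0 _
  have h1 := (hx₀ t ((le_max_left _ _).trans ht)).le
  have h2 := ENNReal.toReal_mono (ENNReal.mul_ne_top ENNReal.ofReal_ne_top (measure_ne_top _ _)) h1
  rw [ENNReal.toReal_mul, ENNReal.toReal_ofReal htα.le] at h2
  rw [Real.rpow_neg ht0.le, ← div_eq_mul_inv, div_le_iff₀ htα, mul_comm]
  exact h2

theorem HasPowerTail.exists_lower {Y : Ω → ℂ} {α : ℝ} (h : HasPowerTail P Y α) :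
    ∃ c : ℝ, 0 < c ∧ ∃ x₀ : ℝ, 0 < x₀ ∧
      ∀ t, x₀ ≤ t → c * t ^ (-α) ≤ P.real {ω | t < ‖Y ω - 1‖} := by
  obtain ⟨c, hc, x₀, hx₀, hbd⟩ := h.eventually_le
  -- For t ≥ 1, |Y| > 2t implies |Y - 1| > t; this is the source of the factor 2^{-α}.
  refine ⟨c * 2 ^ (-α), by positivity, max x₀ 1, by positivity, fun t ht => ?_⟩
  have h1 : 1 ≤ t := (le_max_right _ _).trans ht
  have h2 : x₀ ≤ t := (le_max_left _ _).trans ht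
  rw [mul_assoc, ← Real.mul_rpow two_pos.le (by linarith)]
  refine (hbd (2 * t) (by linarith)).trans (measureReal_mono fun ω hω => ?_)
  have hω' : 2 * t < ‖Y ω‖ := hω
  have := norm_sub_norm_le (Y ω) 1
  rw [norm_one] at this
  show t < ‖Y ω - 1‖
  linarith

/-- If p ≥ α then Y lies in L^α and E[|Y|^α; |Y| > n] tends to 0. But this expectation is at least
n^α P(|Y| > n), which stays above a positive constant. -/
theorem HasPowerTail.lt_of_memLp {Y : Ω → ℂ} {α p : ℝ} (h : HasPowerTail P Y α) (hα : 0 < α)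
    (hYm : Measurable Y) (hY : MemLp Y (ENNReal.ofReal p) P) : p < α := by
  by_contra! hpα
  have hYα : MemLp Y (ENNReal.ofReal α) P := hY.mono_exponent (ENNReal.ofReal_le_ofReal hpα)
  obtain ⟨c, hc, x₀, hx₀, hbd⟩ := h.eventually_le
  have hfin : ∫⁻ ω, ‖Y ω‖ₑ ^ α ∂P ≠ ∞ := by
    have := lintegral_rpow_enorm_lt_top_of_eLpNorm_lt_top (by simpa using hα)
      ENNReal.ofReal_ne_top hYα.2
    rw [ENNReal.toReal_ofReal hα.le] at this
    exact this.ne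
  have hset : ∀ n : ℕ, MeasurableSet {ω | (n : ℝ) < ‖Y ω‖} := fun n =>
    measurableSet_lt measurable_const hYm.norm
  have hlim : Tendsto (fun n : ℕ => ∫⁻ ω, {ω | (n : ℝ) < ‖Y ω‖}.indicator (fun ω => ‖Y ω‖ₑ ^ α) ω ∂P)
      atTop (𝓝 (∫⁻ _, 0 ∂P)) := by
    refine tendsto_lintegral_of_dominated_convergence (fun ω => ‖Y ω‖ₑ ^ α)
      (fun n => (hYm.enorm.pow_const α).indicator (hset n))
      (fun n => ae_of_all _ fun ω => Set.indicator_le_self _ _ _) hfin (ae_of_all _ fun ω => ?_)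
    refine tendsto_const_nhds.congr' ?_
    filter_upwards [eventually_ge_atTop ⌈‖Y ω‖⌉₊] with n hn
    rw [Set.indicator_of_notMem]
    intro hω
    have hω' : (n : ℝ) < ‖Y ω‖ := hω
    exact hω'.not_ge (Nat.ceil_le.1 hn)
  rw [lintegral_zero] at hlim
  have hlow : ∀ᶠ n : ℕ in atTop, ENNReal.ofReal c
      ≤ ∫⁻ ω, {ω | (n : ℝ) < ‖Y ω‖}.indicator (fun ω => ‖Y ω‖ₑ ^ α) ω ∂P := by
    filter_upwards [eventually_ge_atTop ⌈x₀⌉₊] with n hn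
    have hn' : x₀ ≤ n := Nat.ceil_le.1 hn
    have hn0 : (0 : ℝ) < n := hx₀.trans_le hn'
    have hnα : 0 < (n : ℝ) ^ α := Real.rpow_pos_of_pos hn0 _
    calc ENNReal.ofReal c ≤ ENNReal.ofReal ((n : ℝ) ^ α) * P {ω | (n : ℝ) < ‖Y ω‖} := by
          rw [← ofReal_measureReal, ← ENNReal.ofReal_mul hnα.le]
          refine ENNReal.ofReal_le_ofReal ?_
          have := hbd n hn'
          rwa [Real.rpow_neg hn0.le, ← div_eq_mul_inv, div_le_iff₀ hnα, mul_comm] at this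
      _ = ∫⁻ ω, {ω | (n : ℝ) < ‖Y ω‖}.indicator (fun _ => ENNReal.ofReal ((n : ℝ) ^ α)) ω ∂P := by
          rw [lintegral_indicator_const (hset n)]
      _ ≤ _ := by
          refine lintegral_mono fun ω => ?_
          refine Set.indicator_le_indicator' fun hω => ?_
          have hω' : (n : ℝ) < ‖Y ω‖ := hω
          rw [← ofReal_norm, ENNReal.ofReal_rpow_of_nonneg (norm_nonneg _) hα.le]
          gcongr
  have := ge_of_tendsto hlim hlow
  simp only [nonpos_iff_eq_zero, ENNReal.ofReal_eq_zero] at this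
  linarith

end PowerTail

/-! ### Fractional moments of a uniformly integrable family -/

section UniformIntegrability

variable {Ω ι : Type*} [MeasurableSpace Ω] {P : Measure Ω}

/-- Uniform integrability leaves at least half of the unit mass on {|f_n| < C}, where |f_n| is at
most a constant times |f_n|^r. -/
theorem exists_le_lintegral_rpow_of_uniformIntegrable {f : ι → Ω → ℂ} (hf : ∀ n, Measurable (f n))
    (hUI : UniformIntegrable f 1 P) (h1 : ∀ n, ∫⁻ ω, ‖f n ω‖ₑ ∂P = 1) {r : ℝ} (hr0 : 0 < r)
    (hr1 : r < 1) : ∃ ε : ℝ≥0∞, 0 < ε ∧ ∀ n, ε ≤ ∫⁻ ω, ‖f n ω‖ₑ ^ r ∂P := by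
  obtain ⟨C, hC⟩ := hUI.spec one_ne_zero ENNReal.one_ne_top (ε := 1 / 2) (by norm_num)
  -- C + 1 instead of C keeps D nonzero when C = 0.
  set D : ℝ≥0∞ := (C + 1 : NNReal) ^ (1 - r) with hD
  have hDtop : D ≠ ∞ := ENNReal.rpow_ne_top_of_nonneg (by linarith) ENNReal.coe_ne_top
  have hD0 : D ≠ 0 := (ENNReal.rpow_pos (by simp) ENNReal.coe_ne_top).ne'
  have half : ENNReal.ofReal (1 / 2) = 2⁻¹ := by
    rw [one_div, ENNReal.ofReal_inv_of_pos two_pos, ENNReal.ofReal_ofNat]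
  refine ⟨2⁻¹ / D, ENNReal.div_pos (by simp) hDtop, fun n => ?_⟩
  rw [ENNReal.div_le_iff_le_mul (Or.inl hD0) (Or.inl hDtop)]
  have hCn := hC n
  rw [eLpNorm_one_eq_lintegral_enorm, half] at hCn
  have hpt : ∀ ω, ‖f n ω‖ₑ ≤ ‖{x | C ≤ ‖f n x‖₊}.indicator (f n) ω‖ₑ + D * ‖f n ω‖ₑ ^ r := by
    intro ω
    by_cases h : C ≤ ‖f n ω‖₊
    · rw [Set.indicator_of_mem (by exact h)]
      exact le_self_add
    · refine le_trans ?_ le_add_self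
      have h' : ‖f n ω‖ₑ ≤ (C + 1 : NNReal) := by
        rw [enorm_eq_nnnorm, ENNReal.coe_le_coe]
        exact (not_le.1 h).le.trans le_self_add
      calc ‖f n ω‖ₑ = ‖f n ω‖ₑ ^ ((1 - r) + r) := by rw [sub_add_cancel, ENNReal.rpow_one]
        _ = ‖f n ω‖ₑ ^ (1 - r) * ‖f n ω‖ₑ ^ r :=
          ENNReal.rpow_add_of_nonneg _ _ (by linarith) hr0.le
        _ ≤ _ := by
          gcongr
          exact ENNReal.rpow_le_rpow h' (by linarith)
  have hsum : (1 : ℝ≥0∞) ≤ 2⁻¹ + D * ∫⁻ ω, ‖f n ω‖ₑ ^ r ∂P := by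
    rw [← h1 n, ← lintegral_const_mul' _ _ hDtop]
    refine (lintegral_mono hpt).trans ?_
    rw [lintegral_add_right _ (((hf n).enorm.pow_const r).const_mul D)]
    gcongr
  rw [← ENNReal.inv_two_add_inv_two] at hsum
  rw [mul_comm]
  exact (ENNReal.add_le_add_iff_left (by simp)).1 hsum

end UniformIntegrability

/-! ### The two cases of the moment assumption, and the theorem -/

namespace BranchingRandomWalk

variable {Ω : Type*} [MeasurableSpace Ω] {P : Measure Ω} (B : BranchingRandomWalk P)

theorem measure_lt_norm_innov (z : ℂ) (u : List ℕ) (t : ℝ) :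
    P {ω | t < ‖B.innov z u ω‖} = P {ω | t < ‖B.biggins 1 z ω - 1‖} := by
  have h := (B.identDistrib_innov z u).measure_mem_eq (s := {w : ℂ | t < ‖w‖})
    (measurableSet_lt measurable_const measurable_norm)
  simp only [biggins_one, add_sub_cancel_right]
  exact h

variable [IsProbabilityMeasure P]

theorem innov_bounds_of_sq {z : ℂ} (hz : B.LaplaceFinite z.re) (h0 : B.laplace z ≠ 0)
    (hnondeg : ¬ ∀ᵐ ω ∂P, B.biggins 1 z ω = 1)
    (hsq : ∫⁻ ω, ‖B.biggins 1 z ω‖ₑ ^ 2 ∂P < ∞) :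
    (∃ C : ℝ, 0 ≤ C ∧ ∀ (s : Finset (List ℕ)) (a : List ℕ → ℂ) (x : ℝ), 0 < x →
      P {ω | x < ‖∑ u ∈ s, a u * B.innov z u ω‖}
        ≤ ENNReal.ofReal (C * (∑ u ∈ s, ‖a u‖ ^ (2 : ℝ)) * x ^ (-2 : ℝ))) ∧
    ∃ c : ℝ, 0 < c ∧ ∀ (s : Finset (List ℕ)) (a : List ℕ → ℂ),
      ENNReal.ofReal (c * (∑ u ∈ s, ‖a u‖ ^ (2 : ℝ)) ^ (1 / (2 : ℝ)))
        ≤ 8 * ∫⁻ ω, ‖∑ u ∈ s, a u * B.innov z u ω‖ₑ ∂P := by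
  have hZ : MemLp (B.biggins 1 z) 2 P := by
    refine ⟨(B.measurable_biggins 1 z).aestronglyMeasurable, ?_⟩
    rw [eLpNorm_lt_top_iff_lintegral_rpow_enorm_lt_top (by norm_num) (by norm_num)]
    simpa using hsq
  have hinnov : B.innov z [] = fun ω => B.biggins 1 z ω - 1 := by
    funext ω
    rw [biggins_one, add_sub_cancel_right]
  have hL2 : ∀ u, MemLp (B.innov z u) 2 P := fun u => by
    rw [(B.identDistrib_innov z u).memLp_iff, hinnov]
    exact hZ.sub (memLp_const 1)
  constructor
  · have hfin : ∫⁻ ω, ‖B.innov z [] ω‖ₑ ^ 2 ∂P < ∞ := by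
      have := (eLpNorm_lt_top_iff_lintegral_rpow_enorm_lt_top (by norm_num) (by norm_num)).1 (hL2 []).2
      simpa using this
    refine ⟨(∫⁻ ω, ‖B.innov z [] ω‖ₑ ^ 2 ∂P).toReal, ENNReal.toReal_nonneg, fun s a x hx => ?_⟩
    refine (measure_lt_norm_sum_le_of_sq (B.measurable_innov z) hL2 (B.iIndepFun_innov z)
      (B.integral_innov hz h0) (K := (∫⁻ ω, ‖B.innov z [] ω‖ₑ ^ 2 ∂P).toReal)
      ENNReal.toReal_nonneg (fun u => ?_) s a hx).trans (le_of_eq ?_)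
    · rw [ENNReal.ofReal_toReal hfin.ne]
      exact ((B.identDistrib_innov z u).comp (measurable_enorm.pow_const 2)).lintegral_eq.le
    · rw [Real.rpow_neg hx.le, Real.rpow_two, div_eq_mul_inv]
      simp only [Real.rpow_two]
  · have hne : ∫⁻ ω, ‖B.innov z [] ω‖ₑ ∂P ≠ 0 := by
      intro h
      rw [lintegral_eq_zero_iff (B.measurable_innov z []).enorm] at h
      refine hnondeg ?_
      filter_upwards [h] with ω hω
      rw [biggins_one, enorm_eq_zero.1 hω, zero_add]
    have htop : ∫⁻ ω, ‖B.innov z [] ω‖ₑ ∂P ≠ ∞ := (B.integrable_innov hz []).2.ne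
    refine ⟨(∫⁻ ω, ‖B.innov z [] ω‖ₑ ∂P).toReal, ENNReal.toReal_pos hne htop, fun s a => ?_⟩
    refine le_trans (le_of_eq ?_) (le_lintegral_enorm_sum_of_le_lintegral_enorm
      (B.measurable_innov z) (B.integrable_innov hz) (B.iIndepFun_innov z) (B.integral_innov hz h0)
      (κ := (∫⁻ ω, ‖B.innov z [] ω‖ₑ ∂P).toReal) ENNReal.toReal_nonneg (fun u => ?_) s a)
    · rw [Real.sqrt_eq_rpow]
      simp only [Real.rpow_two]
    · rw [ENNReal.ofReal_toReal htop]
      exact ((B.identDistrib_innov z u).comp measurable_enorm).lintegral_eq.ge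

theorem innov_bounds_of_hasPowerTail {z : ℂ} (hz : B.LaplaceFinite z.re) (h0 : B.laplace z ≠ 0)
    {α : ℝ} (hα1 : 1 < α) (hα2 : α < 2) (htail : HasPowerTail P (B.biggins 1 z) α) :
    (∃ C : ℝ, 0 ≤ C ∧ ∀ (s : Finset (List ℕ)) (a : List ℕ → ℂ) (x : ℝ), 0 < x →
      P {ω | x < ‖∑ u ∈ s, a u * B.innov z u ω‖}
        ≤ ENNReal.ofReal (C * (∑ u ∈ s, ‖a u‖ ^ α) * x ^ (-α))) ∧
    ∃ c : ℝ, 0 < c ∧ ∀ (s : Finset (List ℕ)) (a : List ℕ → ℂ),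
      ENNReal.ofReal (c * (∑ u ∈ s, ‖a u‖ ^ α) ^ (1 / α))
        ≤ 8 * ∫⁻ ω, ‖∑ u ∈ s, a u * B.innov z u ω‖ₑ ∂P := by
  have hα0 : 0 < α := by linarith
  constructor
  · obtain ⟨K, hK, hbd⟩ := htail.exists_upper hα0
    exact exists_measure_lt_norm_sum_le (B.measurable_innov z) (B.integrable_innov hz)
      (B.iIndepFun_innov z) (B.integral_innov hz h0) hK hα1 hα2
      fun u t ht => (B.measure_lt_norm_innov z u t).trans_le (hbd t ht)
  · obtain ⟨c, hc, x₀, hx₀, hbd⟩ := htail.exists_lower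
    have hcx : 0 < c * x₀ ^ (-α) := by positivity
    refine ⟨x₀ * (1 - Real.exp (-(c * x₀ ^ (-α)))), mul_pos hx₀ (sub_pos.2 ?_), fun s a => ?_⟩
    · rw [Real.exp_lt_one_iff]
      linarith
    · refine le_lintegral_enorm_sum_of_tail (B.measurable_innov z) (B.integrable_innov hz)
        (B.iIndepFun_innov z) (B.integral_innov hz h0) hα0 hc hx₀ (fun u t ht => ?_) s a
      rw [measureReal_def, B.measure_lt_norm_innov, ← measureReal_def]
      exact hbd t ht

/-- If `m(αθ) / |m(z)|^α ≥ 1`, the increments of `Z_n(z)` do not tend to `0` in `L¹`. -/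
theorem exists_le_lintegral_biggins_succ_sub {z : ℂ} (hz : B.LaplaceFinite z.re)
    (h0 : B.laplace z ≠ 0) {c α : ℝ} (hc : 0 < c) (hα : 1 < α) (hzα : B.LaplaceFinite (α * z.re))
    (hUI : UniformIntegrable (fun n => B.biggins n ((α * z.re : ℝ) : ℂ)) 1 P)
    (hlow : ∀ (s : Finset (List ℕ)) (a : List ℕ → ℂ),
      ENNReal.ofReal (c * (∑ u ∈ s, ‖a u‖ ^ α) ^ (1 / α))
        ≤ 8 * ∫⁻ ω, ‖∑ u ∈ s, a u * B.innov z u ω‖ₑ ∂P)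
    (hq : 1 ≤ B.laplaceReal (α * z.re) / ‖B.laplace z‖ ^ α) :
    ∃ ε : ℝ≥0∞, 0 < ε ∧
      ∀ n, ε ≤ 8 * ∫⁻ ω, ‖B.biggins (n + 1) z ω - B.biggins n z ω‖ₑ ∂P := by
  have hα0 : 0 < α := by linarith
  have hpos := B.laplaceReal_pos h0 hzα
  have h1 : B.laplace ((α * z.re : ℝ) : ℂ) ≠ 0 := by
    rw [laplace_ofReal]
    exact_mod_cast hpos.ne'
  have hmean : ∀ n, ∫⁻ ω, ‖B.biggins n ((α * z.re : ℝ) : ℂ) ω‖ₑ ∂P = 1 := by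
    intro n
    rw [lintegral_congr_ae (B.enorm_biggins_ofReal hzα h1 n),
      B.lintegral_tsum_coef_one (by simpa using hzα) h1, laplace_ofReal, Complex.norm_real,
      Real.norm_of_nonneg hpos.le, Complex.ofReal_re, div_self hpos.ne', one_pow, ENNReal.ofReal_one]
  obtain ⟨ε, hε, hbd⟩ := exists_le_lintegral_rpow_of_uniformIntegrable
    (fun n => B.measurable_biggins n _) hUI hmean (r := 1 / α) (by positivity)
    (by rw [div_lt_one hα0]; exact hα)
  refine ⟨ENNReal.ofReal c * ε, ENNReal.mul_pos (by simpa using hc) hε.ne', fun n => ?_⟩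
  refine le_trans ?_ (B.le_lintegral_biggins_succ_sub hz h0 hc.le hα0 hlow n)
  refine mul_le_mul_right ((hbd n).trans (lintegral_mono_ae ?_)) _
  filter_upwards [B.enorm_biggins_ofReal hzα h1 n] with ω hω
  refine ENNReal.rpow_le_rpow ?_ (by positivity)
  -- The factor q^n is at least 1 and can be dropped, leaving the fractional moment of Z_n(αθ).
  rw [hω, B.tsum_coef_rpow_eq hα0 hzα h0]
  refine le_mul_of_one_le_left zero_le ?_
  rw [← ENNReal.ofReal_one]
  exact ENNReal.ofReal_le_ofReal (one_le_pow₀ hq)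

end BranchingRandomWalk

theorem ConvergesInLp.tendsto_lintegral_succ_sub {Ω : Type*} [MeasurableSpace Ω] {P : Measure Ω}
    [IsProbabilityMeasure P] {f : ℕ → Ω → ℂ} {p : ℝ} (h : ConvergesInLp P f p) (hp : 1 ≤ p) :
    Tendsto (fun n => ∫⁻ ω, ‖f (n + 1) ω - f n ω‖ₑ ∂P) atTop (𝓝 0) := by
  obtain ⟨hf, g, hg, hlim⟩ := h
  have hp' : (1 : ℝ≥0∞) ≤ ENNReal.ofReal p := by simpa using hp
  have hsum : Tendsto (fun n => eLpNorm (fun ω => f (n + 1) ω - g ω) (ENNReal.ofReal p) P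
      + eLpNorm (fun ω => f n ω - g ω) (ENNReal.ofReal p) P) atTop (𝓝 0) := by
    simpa using (hlim.comp (tendsto_add_atTop_nat 1)).add hlim
  refine tendsto_of_tendsto_of_tendsto_of_le_of_le tendsto_const_nhds hsum (fun n => zero_le)
    fun n => ?_
  have hd : ∀ n, AEStronglyMeasurable (fun ω => f n ω - g ω) P := fun n => (hf n).1.sub hg.1
  have e : (fun ω => f (n + 1) ω - f n ω) = (fun ω => f (n + 1) ω - g ω) - fun ω => f n ω - g ω := by
    funext ω
    simp
  rw [← eLpNorm_one_eq_lintegral_enorm]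
  calc _ ≤ eLpNorm (fun ω => f (n + 1) ω - f n ω) (ENNReal.ofReal p) P :=
        eLpNorm_le_eLpNorm_of_exponent_le hp' ((hf (n + 1)).1.sub (hf n).1)
    _ ≤ _ := by
        rw [e]
        exact eLpNorm_sub_le (hd _) (hd _) hp'

theorem theorem3p2 {Ω : Type*} [MeasurableSpace Ω] (P : Measure Ω) [IsProbabilityMeasure P]
    (B : BranchingRandomWalk P)
    (supercritical : 1 < ∫⁻ ω, (B.J [] ω : ℝ≥0∞) ∂P)
    (p θ γ α : ℝ) (lam : ℂ) (hp : 1 < p) (hp2 : p < 2) (hθ : θ ≠ 0) (hγ : γ ≠ 0)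
    (hlam : lam = (θ : ℂ) + (γ : ℂ) * Complex.I)
    (hmθ : B.LaplaceFinite θ)
    (hm_pos : 0 < ‖B.laplace lam‖) (hm_lt : ‖B.laplace lam‖ < B.laplaceReal θ)
    (hnondeg : ¬ ∀ᵐ ω ∂P, B.biggins 1 lam ω = 1)
    (hα : (α = 2 ∧ ∫⁻ ω, ‖B.biggins 1 lam ω‖ₑ ^ 2 ∂P < ∞) ∨
      (1 < α ∧ α < 2 ∧ HasPowerTail P (B.biggins 1 lam) α))
    (hmα : B.LaplaceFinite (α * θ))
    (hUI : UniformIntegrable (fun n => B.biggins n ((α * θ : ℝ) : ℂ)) 1 P) :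
    ConvergesInLp P (fun n => B.biggins n lam) p ↔
      p < α ∧ B.laplaceReal (α * θ) / ‖B.laplace lam‖ ^ α < 1 := by
  have hre : lam.re = θ := by simp [hlam]
  have h0 : B.laplace lam ≠ 0 := norm_pos_iff.1 hm_pos
  have hz : B.LaplaceFinite lam.re := by rwa [hre]
  have hα1 : 1 < α := by
    rcases hα with ⟨rfl, _⟩ | ⟨h, _⟩
    · norm_num
    · exact h
  have hα0 : 0 < α := by linarith
  rw [← hre] at hmα hUI ⊢
  obtain ⟨⟨C, hC, hweak⟩, c, hc, hlow⟩ :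
      (∃ C : ℝ, 0 ≤ C ∧ ∀ (s : Finset (List ℕ)) (a : List ℕ → ℂ) (x : ℝ), 0 < x →
        P {ω | x < ‖∑ u ∈ s, a u * B.innov lam u ω‖}
          ≤ ENNReal.ofReal (C * (∑ u ∈ s, ‖a u‖ ^ α) * x ^ (-α))) ∧
      ∃ c : ℝ, 0 < c ∧ ∀ (s : Finset (List ℕ)) (a : List ℕ → ℂ),
        ENNReal.ofReal (c * (∑ u ∈ s, ‖a u‖ ^ α) ^ (1 / α))
          ≤ 8 * ∫⁻ ω, ‖∑ u ∈ s, a u * B.innov lam u ω‖ₑ ∂P := by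
    rcases hα with ⟨rfl, hsq⟩ | ⟨_, hα2, htail⟩
    · exact B.innov_bounds_of_sq hz h0 hnondeg hsq
    · exact B.innov_bounds_of_hasPowerTail hz h0 hα1 hα2 htail
  constructor
  · intro hconv
    refine ⟨?_, ?_⟩
    · rcases hα with ⟨rfl, _⟩ | ⟨_, _, htail⟩
      · exact hp2
      -- Convergence in L^p includes Z_1(λ) ∈ L^p.
      · exact htail.lt_of_memLp hα0 (B.measurable_biggins 1 lam) (hconv.1 1)
    · by_contra! hq
      obtain ⟨ε, hε, hbd⟩ := B.exists_le_lintegral_biggins_succ_sub hz h0 hc hα1 hmα hUI hlow hq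
      have hlim := ENNReal.Tendsto.const_mul (a := 8) (hconv.tendsto_lintegral_succ_sub hp.le)
        (Or.inr (by norm_num))
      rw [mul_zero] at hlim
      exact hε.not_ge (ge_of_tendsto' hlim hbd)
  · rintro ⟨hpα, hq⟩
    -- The ratio of the geometric bound is q^{1/α} < 1.
    refine convergesInLp_of_geometric hp.le (fun n => B.measurable_biggins n lam) ?_
      ENNReal.ofReal_ne_top ?_
      (B.eLpNorm_biggins_succ_sub_le hz h0 hC (by linarith) hpα hmα hweak)
    · simp only [funext (B.biggins_zero lam)]
      exact memLp_const 1
    · rw [← ENNReal.ofReal_one]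
      refine (ENNReal.ofReal_lt_ofReal_iff one_pos).2 ?_
      refine Real.rpow_lt_one ?_ hq (by positivity)
      have := B.laplaceReal_nonneg (α * lam.re)
      positivity
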